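/- **Setting.** Let $f:\mathbb R^d\to\mathbb R$ be differentiable and bounded below with $\|\nabla f(x)-\nabla f(y)\|\le L\|x-y\|$ for all $x,y$, where $L>0$. Let $x_0\in\mathbb R^d$ with $\Delta:=f(x_0)-\inf f>0$, and let $\epsilon>0$, $p\in(1,2]$, $\sigma\ge 0$. Let $\mathcal D$ be a probability distribution and let $g(x;\xi)$ (e.g. $g=\nabla_xF$) be a jointly measurable stochastic gradient with $\mathbb E_{\xi\sim\mathcal D}[g(x;\xi)]=\nabla f(x)$ and $\mathbb E_{\xi\sim\mathcal D}\|g(x;\xi)-\nabla f(x)\|^p\le\sigma^p$ for all $x$. **Universal computation model.** There are $n\ge1$ workers. Worker $i$ has a computation power $\upsilon_i:\mathbb R_{\ge0}\to\mathbb R_{\ge0}$, which is continuous almost everywhere and integrable on bounded intervals. A stochastic gradient computation that worker $i$ starts at time $s$ is complete at the first time $t\ge s$ with $\int_s^t\upsilon_i(\tau)\,d\tau\ge1$; so a worker that starts at time $t_0$ and is never idle completes $\lfloor\int_{t_0}^{t_1}\upsilon_i(\tau)\,d\tau\rfloor$ gradients by time $t_1$. Communication and server updates take no time. **Algorithm (RANSGDm)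 with inputs $R,\eta,\beta,K$.** The server starts with $k=0$, the point $x_0$, and $v_0=0$. At time $0$ all workers receive $(x_0,0)$. A worker that holds $(x_\iota,\iota)$ draws a fresh $\xi\sim\mathcal D$ (all draws are independent), computes $g=g(x_\iota;\xi)$, sends $(g,\iota)$ to the server, and, once the server has processed it, immediately receives the current pair $(x_k,k)$ and starts again. On receiving $(g,\iota)$ while $k<K$, the server discards it if $k-\iota\ge R$; otherwise it sets $$v_{k+1}=\beta_kv_k+(1-\beta)g,\qquad x_{k+1}=x_k-\eta\,\frac{v_{k+1}}{\|v_{k+1}\|},\qquad k\leftarrow k+1,$$ where $\beta_k=0$ for $k\le1$, $\beta_k=\beta$ for $k>1$, and $v/\|v\|:=0$ for $v=0$. Gradients that arrive simultaneously are processed one after the other, in any order that does not depend on the samples. When $k=K$ the server stops and outputs $\hat x$ drawn uniformly from $\{x_0,\dots,x_{K-1}\}$, independently of the samples. **Parameters.** Put $$\alpha=\min\Bigl\{1,\Bigl(\frac{\epsilon}{3\cdot2^{(p+1)/p}\sigma}\Bigr)^{\frac p{p-1}}\Bigr\}\quad(\alpha=1\text{ if }\sigma=0),$$ $$R=\Bigl\lceil\frac1\alpha\Bigr\rceil,\quad\eta=\frac{\alpha\epsilon}{24L},\quad\beta=1-\alpha,\quad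 K=\Bigl\lceil\frac{72L\Delta}{\alpha\epsilon^2}\Bigr\rceil,\quad\bar K=\Bigl\lceil\frac{74L\Delta}{\epsilon^2}\Bigr\rceil.$$ Define $T_0=0$ and, for $k\ge1$, $$T_k=\min\Bigl\{T\ge0:\ \sum_{i=1}^n\Bigl\lfloor\frac14\int_{T_{k-1}}^{T}\upsilon_i(\tau)\,d\tau\Bigr\rfloor\ge R\Bigr\},$$ where $T_k=\infty$ if the set is empty or $T_{k-1}=\infty$. **Claim.** Every finite $T_k$ is an attained minimum. If $T_{\bar K}<\infty$, then by time $T_{\bar K}$ the server has made all its $K$ updates and stopped, and its output satisfies $\mathbb E\|\nabla f(\hat x)\|\le\epsilon$. Moreover, $\bar K=O(L\Delta/\epsilon^2)$ with an absolute constant, for $\epsilon\le\sqrt{2L\Delta}$; and for $\sigma>0$, $R=\Theta\bigl(\lceil\sigma/\epsilon\rceil^{p/(p-1)}\bigr)$ with constants that depend only on $p$. -/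

import Mathlib

open MeasureTheory ProbabilityTheory
open scoped NNReal ENNReal

namespace RANSGDm

noncomputable section

/-! ### Time: universal computation model -/

/-- The computation power `υ : ℝ₊ → ℝ₊` of a worker: nonnegative, almost everywhere continuous, and
with a finite integral over every `[0, t]`. Only the values on `[0, ∞)` matter. -/
structure IsComputationPower (υ : ℝ → ℝ) : Prop where
  nonneg : ∀ t, 0 ≤ t → 0 ≤ υ t
  ae_continuous : ∀ᵐ t ∂(volume.restrict (Set.Ici (0 : ℝ))), ContinuousWithinAt υ (Set.Ici 0) t
  integrable : ∀ t, 0 ≤ t → IntervalIntegrable υ volume 0 t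

/-- The first time `t ≥ 0` at which `Q t` holds (`∞` if there is none). -/
def firstTime (Q : ℝ → Prop) : ℝ≥0∞ :=
  sInf {T : ℝ≥0∞ | ∃ t : ℝ, 0 ≤ t ∧ Q t ∧ T = ENNReal.ofReal t}

/-- `finishTime υ m` is the time at which a worker of power `υ` completes its `m`-th stochastic
gradient (`m = 1, 2, …`). The worker starts at time `0`; a computation that starts at time `s` is
complete at the first time `t ≥ s` with `∫ τ in s..t, υ τ ≥ 1`, and then the next one starts. -/
def finishTime (υ : ℝ → ℝ) : ℕ → ℝ≥0∞
  | 0 => 0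
  | m + 1 =>
    if finishTime υ m = ∞ then ∞
    else firstTime fun t =>
      (finishTime υ m).toReal ≤ t ∧ 1 ≤ ∫ τ in (finishTime υ m).toReal..t, υ τ

/-- `blockGoal υ R s t`: at time `t`, `∑ i, ⌊(1/4) ∫ τ in s..t, υ i τ⌋ ≥ R`. -/
def blockGoal {n : ℕ} (υ : Fin n → ℝ → ℝ) (R : ℕ) (s t : ℝ) : Prop :=
  (R : ℤ) ≤ ∑ i, ⌊(1 / 4 : ℝ) * ∫ τ in s..t, υ i τ⌋

/-- The recursive sequence `T_0 = 0`,
`T_{K+1} = min {T ≥ 0 : ∑ i, ⌊(1/4) ∫ τ in T_K..T, υ i τ⌋ ≥ R}`, with `min ∅ = ∞`. -/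
def blockTime {n : ℕ} (υ : Fin n → ℝ → ℝ) (R : ℕ) : ℕ → ℝ≥0∞
  | 0 => 0
  | K + 1 =>
    if blockTime υ R K = ∞ then ∞
    else firstTime (blockGoal υ R (blockTime υ R K).toReal)

/-! ### The order in which gradients reach the server

`w j` is the worker whose gradient is the `j`-th one (`j = 0, 1, …`) that the server receives. -/

/-- How many of the first `j` received gradients came from worker `i`. -/
def received {n : ℕ} (w : ℕ → Fin n) (j : ℕ) (i : Fin n) : ℕ :=
  ((Finset.range j).filter fun l => w l = i).card

/-- The time at which the `j`-th received gradient reaches the server. -/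
def arrivalTime {n : ℕ} (υ : Fin n → ℝ → ℝ) (w : ℕ → Fin n) (j : ℕ) : ℝ≥0∞ :=
  finishTime (υ (w j)) (received w j (w j) + 1)

/-- The server receives gradients in the order of their completion; simultaneous ones come one
after the other, in any order. (Events at time `∞` never happen; their order is irrelevant.) -/
def IsSchedule {n : ℕ} (υ : Fin n → ℝ → ℝ) (w : ℕ → Fin n) : Prop :=
  ∀ j i, arrivalTime υ w j ≤ finishTime (υ i) (received w j i + 1)

/-! ### The algorithm -/

/-- The state of server and workers. -/
structure State (n : ℕ) (E : Type*) where
  /-- the iteration counter of the server -/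
  k : ℕ
  /-- the iterates `x 0, …, x k` produced so far (values at larger indices are meaningless) -/
  x : ℕ → E
  /-- the momentum vector `v_k` -/
  v : E
  /-- the point at which worker `i` is computing a stochastic gradient -/
  point : Fin n → E
  /-- the iteration number `ι` that worker `i` received together with that point -/
  stamp : Fin n → ℕ

/-- The inputs of the algorithm. -/
structure Params where
  /-- delay threshold -/
  R : ℕ
  /-- stepsize -/
  η : ℝ
  /-- momentum parameter -/
  β : ℝ
  /-- number of iterations -/
  K : ℕ

section Algorithm

variable {n : ℕ} {E : Type*} [NormedAddCommGroup E] [NormedSpace ℝ E] {Ξ : Type*}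

/-- All workers have requested and received `(x_0, 0)`. -/
def State.init (x₀ : E) : State n E where
  k := 0
  x := fun _ => x₀
  v := 0
  point := fun _ => x₀
  stamp := fun _ => 0

/-- The momentum weight `β_k`. -/
def momentumWeight (β : ℝ) (k : ℕ) : ℝ := if k ≤ 1 then 0 else β

/-- One update of the server with the gradient `g`; for `v_{k+1} = 0` the step `v / ‖v‖` is `0`. -/
def State.update (a : Params) (g : E) (s : State n E) : State n E :=
  let v' := momentumWeight a.β s.k • s.v + (1 - a.β) • g
  { s with
    k := s.k + 1
    x := Function.update s.x (s.k + 1) (s.x s.k - a.η • (‖v'‖⁻¹ • v'))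
    v := v' }

/-- The server receives a data request of worker `i` and sends `(x_k, k)`. -/
def State.serve (i : Fin n) (s : State n E) : State n E :=
  { s with
    point := Function.update s.point i (s.x s.k)
    stamp := Function.update s.stamp i s.k }

/-- The server receives `(g, ι)` from worker `i`: it makes an update if the delay `k - ι` is below
the threshold, and discards `g` otherwise; then worker `i` requests new data. Nothing happens once
the loop `while k < K` has ended. -/
def State.receive (a : Params) (i : Fin n) (g : E) (s : State n E) : State n E :=
  if s.k < a.K then
    State.serve i (if s.k - s.stamp i < a.R then State.update a g s else s)
  else s

/-- The state after the server has received `j` gradients, where `G y z` is the stochastic gradient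
at the point `y` with the sample `z`, and `ξ i m` is the sample that worker `i` draws for its
`m`-th computation (`m = 0, 1, …`). -/
def run (a : Params) (G : E → Ξ → E) (x₀ : E) (w : ℕ → Fin n) (ξ : Fin n → ℕ → Ξ) :
    ℕ → State n E
  | 0 => State.init x₀
  | j + 1 =>
    let s := run a G x₀ w ξ j
    s.receive a (w j) (G (s.point (w j)) (ξ (w j) (received w j (w j))))

end Algorithm

/-! ### Assumptions on the problem -/

/-- `f` is `L`-smooth and bounded below. -/
structure IsSmoothObjective {d : ℕ} (f : EuclideanSpace ℝ (Fin d) → ℝ) (L : ℝ) : Prop where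
  pos : 0 < L
  differentiable : Differentiable ℝ f
  lipschitz : ∀ x y, ‖gradient f x - gradient f y‖ ≤ L * ‖x - y‖
  bddBelow : BddBelow (Set.range f)

/-- `G x z`, with `z` drawn from `D`, is an unbiased estimate of the gradient of `f` at `x` whose
`p`-th central moment is at most `σ ^ p`. -/
structure IsBCMOracle {d : ℕ} {Ξ : Type*} [MeasurableSpace Ξ] (D : Measure Ξ)
    (f : EuclideanSpace ℝ (Fin d) → ℝ)
    (G : EuclideanSpace ℝ (Fin d) → Ξ → EuclideanSpace ℝ (Fin d)) (p σ : ℝ) : Prop where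
  measurable : Measurable (Function.uncurry G)
  integrable : ∀ x, Integrable (G x) D
  unbiased : ∀ x, ∫ z, G x z ∂D = gradient f x
  integrable_moment : ∀ x, Integrable (fun z => ‖G x z - gradient f x‖ ^ p) D
  moment_le : ∀ x, ∫ z, ‖G x z - gradient f x‖ ^ p ∂D ≤ σ ^ p

/-! ### Parameter choices -/

/-- `α = min {1, (ε / (3 · 2^((p+1)/p) σ))^(p/(p-1))}`, which is `1` for `σ = 0`. -/
def alpha (p σ ε : ℝ) : ℝ :=
  if σ = 0 then 1 else min 1 ((ε / (3 * 2 ^ ((p + 1) / p) * σ)) ^ (p / (p - 1)))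

/-- `R = ⌈1/α⌉`. -/
def threshold (p σ ε : ℝ) : ℕ := ⌈1 / alpha p σ ε⌉₊

/-- `R = ⌈1/α⌉`, `η = αε/(24L)`, `β = 1 - α`, `K = ⌈72LΔ/(αε²)⌉`. -/
def params (L Δ p σ ε : ℝ) : Params where
  R := threshold p σ ε
  η := alpha p σ ε * ε / (24 * L)
  β := 1 - alpha p σ ε
  K := ⌈72 * L * Δ / (alpha p σ ε * ε ^ 2)⌉₊

/-- `K̄ = ⌈74LΔ/ε²⌉`. -/
def numBlocks (L Δ ε : ℝ) : ℕ := ⌈74 * L * Δ / ε ^ 2⌉₊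

/-- The optimality gap `f x₀ - inf f`. -/
def gap {d : ℕ} (f : EuclideanSpace ℝ (Fin d) → ℝ) (x₀ : EuclideanSpace ℝ (Fin d)) : ℝ :=
  f x₀ - ⨅ x, f x

end

end RANSGDm

namespace RANSGDm

/-! The arrival order `w` is fixed without reference to the samples, and acceptance of a gradient
depends only on the counter and the stamps. Timing and randomness therefore separate.

Timing. After a worker's first delivery in a block `[T_b, T_{b+1}]`, its stamps are at least the
counter at the start of the block, so its gradients are accepted until the block has produced `R`
updates or the run has ended. Hence at most one gradient per worker and block is lost. A worker
whose quarter work has integer part `m ≥ 1` delivers at least `4m` gradients, and `4m - 1 ≥ m`. So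
each block yields `R` updates unless the run ends (`min_le_control_blockTime`), and `K ≤ K̄ R`
(`params_K_le`).

Convergence. A normalized step does not change when `v` is rescaled, so `v_{k+1}` may be divided by
its total weight `W`, which makes it an average of stochastic gradients. By `normalized_step_le`,
`η‖∇f(x_k)‖` is at most the decrease of `f`, plus `2η` times the error of this average, plus
`Lη²/2`. The error has two parts. The drift is at most `Lη(β/α + R - 1)`, because steps have length
at most `η` and delays are below `R` (`norm_momentum_gradient_sub_le`). The noise `N` accumulates
fresh samples, each independent of the point where it is used. The inequality `norm_add_rpow_le`,
whose cross term is linear in the new noise and integrates to zero, gives `E‖N‖^p ≤ 2σ^p α^(p-1) W ≤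
(ε/6)^p W`, so the noise error has mean at most `(ε/6)/√W`. The average of `1/√W` is at most `3/2`
when `Kα ≥ 16`.

If `9LΔ > 2ε²`, then `Kα ≥ 16` and the contributions add up to at most `ε`. Otherwise the initial
gradient and the possible drift are so small that the average gradient norm is at most `ε` on every
path. -/

/-! ### First times and the flow of received gradients -/

/-- `F` is the work that a worker of power `υ` has done since time `0`, extended to a continuous
monotone function on the line. -/
structure IsCumulativeWork (υ F : ℝ → ℝ) : Prop where
  continuous : Continuous F
  monotone : Monotone F
  zero : F 0 = 0
  integral_eq : ∀ s t, 0 ≤ s → 0 ≤ t → ∫ τ in s..t, υ τ = F t - F s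

theorem IsComputationPower.exists_isCumulativeWork {υ : ℝ → ℝ} (h : IsComputationPower υ) :
    ∃ F, IsCumulativeWork υ F := by
  -- Nothing is known about `υ` at negative times, so it is cut off there before integration.
  set u : ℝ → ℝ := Set.indicator (Set.Ici 0) υ with hu
  have hint : ∀ a b, IntervalIntegrable u volume a b := by
    intro a b
    set c := max |a| |b|
    have hc : 0 ≤ c := (abs_nonneg a).trans (le_max_left _ _)
    have h1 : IntegrableOn υ (Set.Icc 0 c) :=
      (intervalIntegrable_iff_integrableOn_Icc_of_le hc).1 (h.integrable c hc)
    have h2 : IntegrableOn (Set.indicator (Set.Icc 0 c) υ) (Set.uIoc a b) :=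
      (h1.integrable_indicator measurableSet_Icc).integrableOn
    rw [intervalIntegrable_iff]
    refine h2.congr_fun (fun t ht => ?_) measurableSet_uIoc
    have htc : t ≤ c := by
      rcases Set.mem_uIoc.1 ht with h | h
      · exact h.2.trans ((le_abs_self b).trans (le_max_right _ _))
      · exact h.2.trans ((le_abs_self a).trans (le_max_left _ _))
    by_cases h0 : 0 ≤ t
    · rw [Set.indicator_of_mem (Set.mem_Icc.2 ⟨h0, htc⟩), hu,
        Set.indicator_of_mem (Set.mem_Ici.2 h0)]
    · rw [Set.indicator_of_notMem (fun h => h0 h.1), hu,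
        Set.indicator_of_notMem (s := Set.Ici 0) (by simpa using h0)]
  have hnn : ∀ t, 0 ≤ u t := fun t => Set.indicator_nonneg (fun t ht => h.nonneg t ht) t
  refine ⟨fun t => ∫ τ in 0..t, u τ, intervalIntegral.continuous_primitive hint 0, ?_, by simp, ?_⟩
  · intro s t hst
    have := intervalIntegral.integral_interval_sub_left (hint 0 t) (hint 0 s)
    have h2 : 0 ≤ ∫ τ in s..t, u τ := intervalIntegral.integral_nonneg hst fun τ _ => hnn τ
    simp only
    linarith
  · intro s t hs ht
    rw [intervalIntegral.integral_interval_sub_left (hint 0 t) (hint 0 s)]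
    refine intervalIntegral.integral_congr fun τ hτ => ?_
    have : 0 ≤ τ := (le_min hs ht).trans hτ.1
    rw [hu, Set.indicator_of_mem (Set.mem_Ici.2 this)]

theorem IsCumulativeWork.nonneg {υ F : ℝ → ℝ} (h : IsCumulativeWork υ F) {t : ℝ} (ht : 0 ≤ t) :
    0 ≤ F t := h.zero ▸ h.monotone ht

/-- Finiteness makes the set nonempty, and a nonempty closed set of nonnegative reals contains its
infimum. -/
theorem isLeast_firstTime {Q : ℝ → Prop} (hc : IsClosed {t | 0 ≤ t ∧ Q t})
    (h : firstTime Q ≠ ∞) : IsLeast {t | 0 ≤ t ∧ Q t} (firstTime Q).toReal := by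
  set S := {t | 0 ≤ t ∧ Q t} with hS
  have hne : S.Nonempty := by
    by_contra hemp
    rw [Set.not_nonempty_iff_eq_empty] at hemp
    apply h
    have : {T : ℝ≥0∞ | ∃ t : ℝ, 0 ≤ t ∧ Q t ∧ T = ENNReal.ofReal t} = ∅ := by
      ext T
      simp only [Set.mem_ofPred_eq, Set.mem_empty_iff_false, iff_false]
      rintro ⟨t, h0, hQ, -⟩
      have : t ∈ S := ⟨h0, hQ⟩
      simp [hemp] at this
    rw [firstTime, this, sInf_empty]
  have hb : BddBelow S := ⟨0, fun t ht => ht.1⟩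
  have hm := hc.csInf_mem hne hb
  have heq : firstTime Q = ENNReal.ofReal (sInf S) := by
    apply le_antisymm
    · exact sInf_le ⟨_, hm.1, hm.2, rfl⟩
    · refine le_sInf ?_
      rintro T ⟨t, h0, hQ, rfl⟩
      exact ENNReal.ofReal_le_ofReal (csInf_le hb ⟨h0, hQ⟩)
  rw [heq, ENNReal.toReal_ofReal hm.1]
  exact ⟨hm, fun t ht => csInf_le hb ht⟩

/-- By continuity of `F`, the work at a finite completion time is exactly `m`. No work is wasted
between consecutive computations, and the recursion becomes a single level crossing. -/
theorem IsCumulativeWork.finishTime_le_iff {υ F : ℝ → ℝ} (h : IsCumulativeWork υ F) (m : ℕ)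
    {t : ℝ} (ht : 0 ≤ t) : finishTime υ m ≤ ENNReal.ofReal t ↔ (m : ℝ) ≤ F t := by
  induction m generalizing t with
  | zero => simpa [finishTime] using h.nonneg ht
  | succ m ih =>
    rw [finishTime]
    split_ifs with htop
    · simp only [top_le_iff, ENNReal.ofReal_ne_top, false_iff, not_le]
      by_contra! hle
      have : finishTime υ m ≤ ENNReal.ofReal t := (ih ht).2 (by push_cast at hle; linarith)
      simp [htop] at this
    · set s := (finishTime υ m).toReal with hs
      have hs0 : 0 ≤ s := ENNReal.toReal_nonneg
      have hfs : finishTime υ m = ENNReal.ofReal s := (ENNReal.ofReal_toReal htop).symm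
      have hFs : F s = m := by
        apply le_antisymm
        -- If `F s > m`, the level `m` was already reached at some `r` with `F r = m < F s`, which
        -- contradicts minimality of `s`.
        · by_contra! hlt
          obtain ⟨r, hr, hFr⟩ := intermediate_value_Icc hs0 h.continuous.continuousOn
            (show (m : ℝ) ∈ Set.Icc (F 0) (F s) from ⟨by rw [h.zero]; positivity, hlt.le⟩)
          have h1 := (ih hr.1).2 hFr.ge
          rw [hfs, ENNReal.ofReal_le_ofReal_iff hr.1] at h1
          have : F s ≤ F r := h.monotone h1
          linarith
        · exact (ih hs0).1 hfs.le
      constructor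
      · intro hle
        have hc : IsClosed {t | 0 ≤ t ∧ (s ≤ t ∧ 1 ≤ ∫ τ in s..t, υ τ)} := by
          have : {t | 0 ≤ t ∧ (s ≤ t ∧ 1 ≤ ∫ τ in s..t, υ τ)} =
              Set.Ici 0 ∩ (Set.Ici s ∩ {t | 1 ≤ F t - F s}) := by
            ext r
            simp only [Set.mem_ofPred_eq, Set.mem_inter_iff, Set.mem_Ici]
            refine and_congr_right fun hr => and_congr_right fun _ => ?_
            rw [h.integral_eq s r hs0 hr]
          rw [this]
          exact isClosed_Ici.inter (isClosed_Ici.inter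
            (isClosed_le continuous_const (h.continuous.sub continuous_const)))
        have hne := (hle.trans_lt ENNReal.ofReal_lt_top).ne
        obtain ⟨⟨h0, -, hQ⟩, -⟩ := isLeast_firstTime hc hne
        rw [h.integral_eq s _ hs0 h0, hFs] at hQ
        have := h.monotone ((ENNReal.toReal_le_of_le_ofReal ht hle))
        push_cast
        linarith
      · intro hle
        push_cast at hle
        have hst : s ≤ t := by
          have := (ih ht).2 (by linarith)
          rwa [hfs, ENNReal.ofReal_le_ofReal_iff ht] at this
        exact sInf_le ⟨t, ht, ⟨hst, by rw [h.integral_eq s t hs0 ht, hFs]; linarith⟩, rfl⟩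

/-- The floor of a continuous function is upper semicontinuous, hence so is the finite sum, and its
superlevel sets are closed. -/
theorem isClosed_blockGoal {n : ℕ} {υ F : Fin n → ℝ → ℝ} (h : ∀ i, IsCumulativeWork (υ i) (F i))
    (R : ℕ) {s : ℝ} (hs : 0 ≤ s) : IsClosed {t | 0 ≤ t ∧ blockGoal υ R s t} := by
  have heq : {t | 0 ≤ t ∧ blockGoal υ R s t} =
      Set.Ici 0 ∩ {t | (R : ℤ) ≤ ∑ i, ⌊(1 / 4 : ℝ) * (F i t - F i s)⌋} := by
    ext t
    simp only [Set.mem_ofPred_eq, Set.mem_inter_iff, Set.mem_Ici, blockGoal]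
    refine and_congr_right fun ht => ?_
    simp only [fun i => (h i).integral_eq s t hs ht]
  rw [heq]
  refine isClosed_Ici.inter ?_
  rw [← isOpen_compl_iff, isOpen_iff_mem_nhds]
  intro t ht
  simp only [Set.mem_compl_iff, Set.mem_ofPred_eq, not_le] at ht
  have hev : ∀ i, ∀ᶠ r in nhds t,
      ⌊(1 / 4 : ℝ) * (F i r - F i s)⌋ ≤ ⌊(1 / 4 : ℝ) * (F i t - F i s)⌋ := by
    intro i
    have hcont : Continuous fun r => (1 / 4 : ℝ) * (F i r - F i s) :=
      continuous_const.mul ((h i).continuous.sub continuous_const)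
    filter_upwards [hcont.continuousAt.eventually_lt continuousAt_const
      (Int.lt_floor_add_one ((1 / 4 : ℝ) * (F i t - F i s)))] with r hr
    rw [← Int.lt_add_one_iff, Int.floor_lt]
    exact_mod_cast hr
  filter_upwards [Filter.eventually_all.2 hev] with r hr
  simp only [Set.mem_compl_iff, Set.mem_ofPred_eq, not_le]
  exact (Finset.sum_le_sum fun i _ => hr i).trans_lt ht

theorem blockTime_ne_top_of_succ {n : ℕ} {υ : Fin n → ℝ → ℝ} {R K : ℕ}
    (hK : blockTime υ R (K + 1) ≠ ∞) : blockTime υ R K ≠ ∞ := by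
  intro htop
  exact hK (by rw [blockTime, if_pos htop])

theorem isLeast_blockTime {n : ℕ} {υ : Fin n → ℝ → ℝ} (h : ∀ i, IsComputationPower (υ i))
    {R K : ℕ} (hK : blockTime υ R (K + 1) ≠ ∞) :
    IsLeast {t : ℝ | 0 ≤ t ∧ blockGoal υ R (blockTime υ R K).toReal t}
      (blockTime υ R (K + 1)).toReal := by
  choose F hF using fun i => (h i).exists_isCumulativeWork
  have hne := blockTime_ne_top_of_succ hK
  have heq : blockTime υ R (K + 1) = firstTime (blockGoal υ R (blockTime υ R K).toReal) := by
    rw [blockTime, if_neg hne]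
  rw [heq] at hK ⊢
  exact isLeast_firstTime (isClosed_blockGoal hF R ENNReal.toReal_nonneg) hK

section Flow

variable {n : ℕ} (w : ℕ → Fin n)

@[simp]
theorem received_zero (i : Fin n) : received w 0 i = 0 := by simp [received]

theorem received_succ (j : ℕ) (i : Fin n) :
    received w (j + 1) i = received w j i + if w j = i then 1 else 0 := by
  rw [received, Finset.range_add_one, Finset.filter_insert]
  split_ifs with h
  · rw [Finset.card_insert_of_notMem (by simp), received]
  · rfl

theorem sum_received (j : ℕ) : ∑ i, received w j i = j := by
  induction j with
  | zero => simp
  | succ j ih => simp [received_succ, Finset.sum_add_distrib, ih]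

theorem received_mono (i : Fin n) : Monotone fun j => received w j i :=
  monotone_nat_of_le_succ fun j => by simp [received_succ]

theorem received_lt_of_lt {l j : ℕ} (h : l < j) : received w l (w l) < received w j (w l) := by
  have := received_mono w (w l) (Nat.succ_le_of_lt h)
  simp only [Nat.succ_eq_add_one, received_succ, if_true] at this
  omega

/-- The computations that the successively received gradients come from are distinct. -/
theorem injective_sampleIndex : Function.Injective fun j => (w j, received w j (w j)) := by
  have key : ∀ l j, l < j → (w l, received w l (w l)) ≠ (w j, received w j (w j)) := by
    intro l j h heq
    obtain ⟨h1, h2⟩ := Prod.mk.inj heq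
    have := received_lt_of_lt w h
    rw [h1] at this h2
    omega
  intro l j heq
  rcases lt_trichotomy l j with h | h | h
  · exact absurd heq (key l j h)
  · exact h
  · exact absurd heq.symm (key j l h)

variable {w}

/-- The gradients received up to time `t` are the first `∑ i, ⌊F i t⌋` ones, where `F i` is the
work done by worker `i`. -/
theorem IsSchedule.received_eq_floor {υ F : Fin n → ℝ → ℝ} (hw : IsSchedule υ w)
    (h : ∀ i, IsCumulativeWork (υ i) (F i)) {t : ℝ} (ht : 0 ≤ t) :
    (∀ i, received w (∑ i, ⌊F i t⌋₊) i = ⌊F i t⌋₊) ∧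
      ∀ j < ∑ i, ⌊F i t⌋₊, arrivalTime υ w j ≤ ENNReal.ofReal t := by
  have hiff : ∀ i m, finishTime (υ i) m ≤ ENNReal.ofReal t ↔ m ≤ ⌊F i t⌋₊ := fun i m => by
    rw [(h i).finishTime_le_iff m ht, Nat.le_floor_iff ((h i).nonneg ht)]
  have key : ∀ j ≤ ∑ i, ⌊F i t⌋₊, (∀ i, received w j i ≤ ⌊F i t⌋₊) ∧
      ∀ l < j, arrivalTime υ w l ≤ ENNReal.ofReal t := by
    intro j
    induction j with
    | zero => simp
    | succ j ih =>
      intro hj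
      obtain ⟨h1, h2⟩ := ih (by omega)
      -- Pigeonhole: fewer gradients have been received than completed by time `t`, so some worker
      -- has one outstanding. The schedule puts the next arrival no later than that one.
      obtain ⟨i, hi⟩ : ∃ i, received w j i < ⌊F i t⌋₊ := by
        by_contra! hge
        have := Finset.sum_le_sum fun i (_ : i ∈ Finset.univ) => hge i
        rw [sum_received] at this
        omega
      have harr : arrivalTime υ w j ≤ ENNReal.ofReal t := (hw j i).trans ((hiff i _).2 hi)
      refine ⟨fun i' => ?_, fun l hl => ?_⟩
      · rw [received_succ]
        split_ifs with hi'
        · rw [← hi']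
          exact (hiff _ _).1 harr
        · exact h1 i'
      · rcases Nat.lt_succ_iff_lt_or_eq.1 hl with hl | rfl
        · exact h2 l hl
        · exact harr
  obtain ⟨h1, h2⟩ := key _ le_rfl
  refine ⟨fun i => ?_, h2⟩
  -- Termwise inequalities between families with equal sums are equalities.
  have := (Finset.sum_eq_sum_iff_of_le fun i _ => h1 i).1 (sum_received w _)
  exact this i (Finset.mem_univ i)

end Flow

/-! ### The iteration counter -/

section Control

variable {n : ℕ}

/-- The iteration counter and the stamps of the workers after `j` received gradients. They do not
depend on the samples. -/
def control (a : Params) (w : ℕ → Fin n) : ℕ → ℕ × (Fin n → ℕ)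
  | 0 => (0, fun _ => 0)
  | j + 1 =>
    if (control a w j).1 < a.K then
      if (control a w j).1 - (control a w j).2 (w j) < a.R then
        ((control a w j).1 + 1, Function.update (control a w j).2 (w j) ((control a w j).1 + 1))
      else ((control a w j).1, Function.update (control a w j).2 (w j) (control a w j).1)
    else control a w j

theorem run_control {E : Type*} [NormedAddCommGroup E] [NormedSpace ℝ E] {Ξ : Type*} (a : Params)
    (G : E → Ξ → E) (x₀ : E) (w : ℕ → Fin n) (ξ : Fin n → ℕ → Ξ) (j : ℕ) :
    (run a G x₀ w ξ j).k = (control a w j).1 ∧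
      (run a G x₀ w ξ j).stamp = (control a w j).2 := by
  induction j with
  | zero => simp [run, State.init, control]
  | succ j ih =>
    obtain ⟨h1, h2⟩ := ih
    simp only [run, State.receive, control, h1, h2]
    split_ifs <;> simp [State.serve, State.update, h1, h2]

variable (a : Params) (w : ℕ → Fin n)

theorem control_succ_fst (j : ℕ) : (control a w (j + 1)).1 =
    if (control a w j).1 < a.K ∧ (control a w j).1 - (control a w j).2 (w j) < a.R then
      (control a w j).1 + 1 else (control a w j).1 := by
  rw [control]
  split_ifs <;> simp_all

theorem control_succ_snd {j : ℕ} (h : (control a w j).1 < a.K) : (control a w (j + 1)).2 =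
    Function.update (control a w j).2 (w j) (control a w (j + 1)).1 := by
  rw [control]
  split_ifs <;> simp_all

theorem control_le_succ (j : ℕ) : (control a w j).1 ≤ (control a w (j + 1)).1 := by
  rw [control_succ_fst]
  split_ifs <;> omega

theorem control_succ_le (j : ℕ) : (control a w (j + 1)).1 ≤ (control a w j).1 + 1 := by
  rw [control_succ_fst]
  split_ifs <;> omega

theorem control_mono : Monotone fun j => (control a w j).1 :=
  monotone_nat_of_le_succ (control_le_succ a w)

theorem control_le (j : ℕ) : (control a w j).1 ≤ a.K := by
  induction j with
  | zero => simp [control]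
  | succ j ih =>
    rw [control_succ_fst]
    split_ifs <;> omega

theorem control_stamp_le (j : ℕ) (i : Fin n) : (control a w j).2 i ≤ (control a w j).1 := by
  induction j with
  | zero => simp [control]
  | succ j ih =>
    by_cases h : (control a w j).1 < a.K
    · rw [control_succ_snd a w h]
      by_cases hi : i = w j
      · subst hi; simp
      · rw [Function.update_of_ne hi]
        exact ih.trans (control_le_succ a w j)
    · rw [control, if_neg h]
      exact ih

/-- As long as fewer than `R` updates have been made since the `j₀`-th gradient, every gradient of a
worker except for its first one is accepted. -/
theorem add_sum_received_le_control {j₀ j : ℕ} (hj : j₀ ≤ j) (hK : (control a w j).1 < a.K)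
    (hR : (control a w j).1 < (control a w j₀).1 + a.R) :
    (∀ i, received w j₀ i < received w j i → (control a w j₀).1 ≤ (control a w j).2 i) ∧
      (control a w j₀).1 + ∑ i, (received w j i - received w j₀ i - 1) ≤ (control a w j).1 := by
  induction j, hj using Nat.le_induction with
  | base => simp
  | succ j hj ih =>
    have hle := control_le_succ a w j
    have hmono : (control a w j₀).1 ≤ (control a w j).1 := control_mono a w hj
    obtain ⟨h1, h2⟩ := ih (by omega) (by omega)
    have hK' : (control a w j).1 < a.K := by omega
    refine ⟨fun i hi => ?_, ?_⟩
    · rw [control_succ_snd a w hK']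
      by_cases hw : i = w j
      · subst hw
        simp only [Function.update_self]
        omega
      · rw [Function.update_of_ne hw]
        rw [received_succ, if_neg (Ne.symm hw), add_zero] at hi
        exact h1 i hi
    -- A worker that has already delivered since `j₀` holds a stamp of at least the counter at `j₀`.
    -- The counter has grown by less than `R`, so the new gradient is accepted.
    · by_cases hfirst : received w j₀ (w j) < received w j (w j)
      · have hst := h1 _ hfirst
        have hacc : (control a w (j + 1)).1 = (control a w j).1 + 1 := by
          rw [control_succ_fst, if_pos ⟨hK', by omega⟩]
        have hsum : ∑ i, (received w (j + 1) i - received w j₀ i - 1) =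
            ∑ i, (received w j i - received w j₀ i - 1) + 1 := by
          rw [← Finset.add_sum_erase _ _ (Finset.mem_univ (w j)),
            ← Finset.add_sum_erase _ _ (Finset.mem_univ (w j))]
          have : ∑ i ∈ Finset.univ.erase (w j), (received w (j + 1) i - received w j₀ i - 1) =
              ∑ i ∈ Finset.univ.erase (w j), (received w j i - received w j₀ i - 1) := by
            refine Finset.sum_congr rfl fun i hi => ?_
            rw [received_succ, if_neg (Finset.ne_of_mem_erase hi).symm, add_zero]
          rw [this, received_succ, if_pos rfl]
          omega
        omega
      -- For the worker's first delivery the truncated difference is `0 - 1 = 0` before and `1 - 1 =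
      -- 0` after, so acceptance does not matter.
      · have hsum : ∑ i, (received w (j + 1) i - received w j₀ i - 1) =
            ∑ i, (received w j i - received w j₀ i - 1) := by
          refine Finset.sum_congr rfl fun i _ => ?_
          rw [received_succ]
          split_ifs with hw
          · subst hw; omega
          · rw [add_zero]
        omega

theorem min_le_control {j₀ j : ℕ} (hj : j₀ ≤ j)
    (h : a.R ≤ ∑ i, (received w j i - received w j₀ i - 1)) :
    min a.K ((control a w j₀).1 + a.R) ≤ (control a w j).1 := by
  by_contra! hlt
  obtain ⟨hK, hR⟩ := lt_min_iff.1 hlt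
  have := (add_sum_received_le_control a w hj hK hR).2
  omega

variable {a w}

/-- Work is not reset at block boundaries: gradients are counted by `⌊F i t⌋ - ⌊F i s⌋`, and one is
subtracted for a computation that may have begun with old data. -/
theorem min_le_control_blockTime {υ F : Fin n → ℝ → ℝ} (hw : IsSchedule υ w)
    (hF : ∀ i, IsCumulativeWork (υ i) (F i)) (hυ : ∀ i, IsComputationPower (υ i)) (hR : 0 < a.R)
    {b : ℕ} (hb : blockTime υ a.R b ≠ ∞) :
    min a.K (b * a.R) ≤
      (control a w (∑ i, ⌊F i (blockTime υ a.R b).toReal⌋₊)).1 := by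
  induction b with
  | zero => simp
  | succ b ih =>
    set s := (blockTime υ a.R b).toReal with hs
    set t := (blockTime υ a.R (b + 1)).toReal with ht
    have hs0 : 0 ≤ s := ENNReal.toReal_nonneg
    have ht0 : 0 ≤ t := ENNReal.toReal_nonneg
    have hgoal : (a.R : ℤ) ≤ ∑ i, ⌊(1 / 4 : ℝ) * (F i t - F i s)⌋ := by
      have := (isLeast_blockTime hυ hb).1.2
      rw [blockGoal] at this
      simpa only [← hs, ← ht, fun i => (hF i).integral_eq s t hs0 ht0] using this
    -- The goal asks for a positive sum, while `t < s` would make every floor nonpositive.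
    have hst : s ≤ t := by
      by_contra! hlt
      have : ∑ i, ⌊(1 / 4 : ℝ) * (F i t - F i s)⌋ ≤ 0 := by
        refine Finset.sum_nonpos fun i _ => ?_
        have := (hF i).monotone hlt.le
        exact Int.floor_nonpos (by linarith)
      omega
    have hJ : ∑ i, ⌊F i s⌋₊ ≤ ∑ i, ⌊F i t⌋₊ :=
      Finset.sum_le_sum fun i _ => Nat.floor_le_floor ((hF i).monotone hst)
    have hcount : a.R ≤ ∑ i, (received w (∑ i, ⌊F i t⌋₊) i - received w (∑ i, ⌊F i s⌋₊) i - 1) := by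
      zify
      refine hgoal.trans (Finset.sum_le_sum fun i _ => ?_)
      rw [(hw.received_eq_floor hF hs0).1 i, (hw.received_eq_floor hF ht0).1 i]
      have h1 : (⌊(1 / 4 : ℝ) * (F i t - F i s)⌋ : ℝ) ≤ (1 / 4 : ℝ) * (F i t - F i s) :=
        Int.floor_le _
      generalize ⌊(1 / 4 : ℝ) * (F i t - F i s)⌋ = m at h1 ⊢
      rcases le_or_gt m 0 with h0 | h0
      · exact h0.trans (by positivity)
      · have h2 := Nat.floor_le ((hF i).nonneg hs0)
        lift m to ℕ using h0.le
        -- The factor `1/4` enters here: `4m` deliveries minus one stale one leave at least `m`, as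
        -- `m ≥ 1`.
        have h3 : ⌊F i s⌋₊ + 4 * m ≤ ⌊F i t⌋₊ := by
          rw [Nat.le_floor_iff ((hF i).nonneg ht0)]
          push_cast at h1 ⊢
          linarith
        omega
    have h1 := min_le_control a w hJ hcount
    have h2 := ih (blockTime_ne_top_of_succ hb)
    have h3 : (b + 1) * a.R = b * a.R + a.R := by ring
    rw [h3]
    refine le_trans ?_ h1
    rcases min_le_iff.1 h2 with h | h <;> omega

theorem exists_control_eq {υ : Fin n → ℝ → ℝ} (hw : IsSchedule υ w)
    (hυ : ∀ i, IsComputationPower (υ i)) (hR : 0 < a.R) {b : ℕ} (hK : a.K ≤ b * a.R)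
    (hb : blockTime υ a.R b ≠ ∞) :
    ∃ J, (∀ j < J, arrivalTime υ w j ≤ blockTime υ a.R b) ∧ (control a w J).1 = a.K := by
  choose F hF using fun i => (hυ i).exists_isCumulativeWork
  refine ⟨∑ i, ⌊F i (blockTime υ a.R b).toReal⌋₊, fun j hj => ?_, ?_⟩
  · have := (hw.received_eq_floor hF ENNReal.toReal_nonneg).2 j hj
    rwa [ENNReal.ofReal_toReal hb] at this
  · have := min_le_control_blockTime hw hF hυ hR hb
    rw [min_eq_left hK] at this
    exact (control_le a w _).antisymm this

/-- The positions of the accepted gradients. -/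
theorem exists_updateIndex {J : ℕ} (hJ : (control a w J).1 = a.K) :
    ∃ idx : ℕ → ℕ, idx a.K = J ∧ (∀ k ≤ a.K, (control a w (idx k)).1 = k) ∧
      ∀ k < a.K, (control a w (idx k + 1)).1 = k + 1 := by
  have key : ∀ k < a.K, ∃ j, (control a w j).1 = k ∧ (control a w (j + 1)).1 = k + 1 := by
    intro k hk
    have hex : ∃ j, k < (control a w j).1 := ⟨J, by omega⟩
    classical
    -- The counter rises by at most one per gradient, so the gradient just before it first exceeds
    -- `k` is the one that causes update `k + 1`.
    obtain ⟨j, hj⟩ : ∃ j, Nat.find hex = j + 1 := by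
      refine Nat.exists_eq_succ_of_ne_zero fun h0 => ?_
      have := Nat.find_spec hex
      rw [h0] at this
      simp [control] at this
    have h1 := Nat.find_spec hex
    have h2 := Nat.find_min hex (m := j) (by omega)
    rw [hj] at h1
    have := control_succ_le a w j
    exact ⟨j, by omega, by omega⟩
  choose! idx h1 h2 using key
  refine ⟨fun k => if k < a.K then idx k else J, by simp, fun k hk => ?_, fun k hk => ?_⟩
  · beta_reduce
    split_ifs with h
    · exact h1 k h
    · omega
  · simpa [hk] using h2 k hk

end Control

/-! ### The trajectory of the algorithm -/

section Trajectory

variable {n : ℕ} {E : Type*} [NormedAddCommGroup E] [NormedSpace ℝ E] {Ξ : Type*}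

/-- `x k`, `v k` are the iterates and momenta of the algorithm, and `y k`, `g k` the point and the
value of the stochastic gradient that is used in iteration `k`. -/
structure IsTrajectory (a : Params) (x₀ : E) (x v y g : ℕ → E) : Prop where
  x_zero : x 0 = x₀
  v_zero : v 0 = 0
  v_succ : ∀ k < a.K, v (k + 1) = momentumWeight a.β k • v k + (1 - a.β) • g k
  x_succ : ∀ k < a.K, x (k + 1) = x k - a.η • (‖v (k + 1)‖⁻¹ • v (k + 1))
  delay : ∀ k < a.K, ∃ m ≤ k, k - m < a.R ∧ y k = x m

variable (a : Params) (G : E → Ξ → E) (x₀ : E) (w : ℕ → Fin n) (ξ : Fin n → ℕ → Ξ)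

theorem run_succ_of_accept {j : ℕ} (hj : (control a w (j + 1)).1 = (control a w j).1 + 1) :
    run a G x₀ w ξ (j + 1) = State.serve (w j) (State.update a
      (G ((run a G x₀ w ξ j).point (w j)) (ξ (w j) (received w j (w j)))) (run a G x₀ w ξ j)) := by
  have h : (control a w j).1 < a.K ∧ (control a w j).1 - (control a w j).2 (w j) < a.R := by
    by_contra hn
    rw [control_succ_fst, if_neg hn] at hj
    omega
  obtain ⟨h1, h2⟩ := run_control a G x₀ w ξ j
  simp only [run, State.receive, h1, h2, if_pos h.1, if_pos h.2]

theorem run_succ_of_reject {j : ℕ} (hj : (control a w (j + 1)).1 = (control a w j).1) :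
    run a G x₀ w ξ (j + 1) = run a G x₀ w ξ j ∨
      run a G x₀ w ξ (j + 1) = State.serve (w j) (run a G x₀ w ξ j) := by
  have h : ¬ ((control a w j).1 < a.K ∧ (control a w j).1 - (control a w j).2 (w j) < a.R) := by
    intro hn
    rw [control_succ_fst, if_pos hn] at hj
    omega
  obtain ⟨h1, h2⟩ := run_control a G x₀ w ξ j
  simp only [run, State.receive, h1, h2]
  by_cases hk : (control a w j).1 < a.K
  · rw [if_pos hk, if_neg fun hr => h ⟨hk, hr⟩]
    exact Or.inr rfl
  · rw [if_neg hk]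
    exact Or.inl rfl

theorem control_succ_cases (j : ℕ) : (control a w (j + 1)).1 = (control a w j).1 ∨
    (control a w (j + 1)).1 = (control a w j).1 + 1 := by
  rw [control_succ_fst]
  split_ifs <;> simp

/-- An update writes only at the index after the counter, so earlier iterates are frozen and can all
be read off the final state. -/
theorem run_x_eq {j j' : ℕ} (hj : j ≤ j') {m : ℕ} (hm : m ≤ (control a w j).1) :
    (run a G x₀ w ξ j').x m = (run a G x₀ w ξ j).x m := by
  induction j', hj using Nat.le_induction with
  | base => rfl
  | succ j' hj ih =>
    rw [← ih]
    have hle : (control a w j).1 ≤ (control a w j').1 := control_mono a w hj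
    rcases control_succ_cases a w j' with h | h
    · rcases run_succ_of_reject a G x₀ w ξ h with h | h <;> rw [h]
      rfl
    · rw [run_succ_of_accept a G x₀ w ξ h]
      simp only [State.serve, State.update]
      rw [Function.update_of_ne]
      rw [(run_control a G x₀ w ξ j').1]
      omega

theorem run_v_eq {j j' : ℕ} (hj : j ≤ j') (h : (control a w j').1 = (control a w j).1) :
    (run a G x₀ w ξ j').v = (run a G x₀ w ξ j).v := by
  induction j', hj using Nat.le_induction with
  | base => rfl
  | succ j' hj ih =>
    have hle : (control a w j).1 ≤ (control a w j').1 := control_mono a w hj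
    have hle' := control_le_succ a w j'
    rw [← ih (by omega)]
    rcases run_succ_of_reject a G x₀ w ξ (j := j') (by omega) with h | h <;> rw [h]
    rfl

theorem run_x_zero (j : ℕ) : (run a G x₀ w ξ j).x 0 = x₀ :=
  run_x_eq a G x₀ w ξ (Nat.zero_le j) (Nat.zero_le _)

/-- This turns the delay in the stamps into a distance between iterates. -/
theorem run_point (j : ℕ) (i : Fin n) :
    (run a G x₀ w ξ j).point i = (run a G x₀ w ξ j).x ((control a w j).2 i) := by
  induction j with
  | zero => simp [run, State.init]
  | succ j ih =>
    have hx := run_x_eq a G x₀ w ξ (Nat.le_succ j) (control_stamp_le a w j i)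
    obtain ⟨h1, h2⟩ := run_control a G x₀ w ξ (j + 1)
    rw [← h2]
    obtain ⟨h3, h4⟩ := run_control a G x₀ w ξ j
    rcases control_succ_cases a w j with h | h
    · rcases run_succ_of_reject a G x₀ w ξ h with h | h <;> rw [h]
      · rw [ih, h4]
      · by_cases hi : i = w j
        · subst hi; simp [State.serve]
        · simp [State.serve, Function.update_of_ne hi, ih, h4]
    · rw [run_succ_of_accept a G x₀ w ξ h] at hx ⊢
      by_cases hi : i = w j
      · subst hi; simp [State.serve]
      · simp only [State.serve, Function.update_of_ne hi] at hx ⊢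
        rw [← h4] at hx
        exact (ih.trans (by rw [h4])).trans hx.symm

/-- Discarded gradients change neither the momentum nor the iterates. Observed only at the accepted
positions, the run is plain delayed momentum descent. -/
theorem isTrajectory_run {J : ℕ} {idx : ℕ → ℕ} (hK : idx a.K = J)
    (h1 : ∀ k ≤ a.K, (control a w (idx k)).1 = k)
    (h2 : ∀ k < a.K, (control a w (idx k + 1)).1 = k + 1) :
    IsTrajectory a x₀ (run a G x₀ w ξ J).x (fun k => (run a G x₀ w ξ (idx k)).v)
      (fun k => (run a G x₀ w ξ (idx k)).point (w (idx k)))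
      (fun k => G ((run a G x₀ w ξ (idx k)).point (w (idx k)))
        (ξ (w (idx k)) (received w (idx k) (w (idx k))))) := by
  have hlt : ∀ k < a.K, ∀ l ≤ a.K, k < l → idx k + 1 ≤ idx l := by
    intro k hk l hl hkl
    by_contra! hlt
    have : (control a w (idx l)).1 ≤ (control a w (idx k)).1 := control_mono a w (by omega)
    rw [h1 k hk.le, h1 l hl] at this
    omega
  have hv : ∀ k < a.K, (run a G x₀ w ξ (idx (k + 1))).v = (run a G x₀ w ξ (idx k + 1)).v :=
    fun k hk => run_v_eq a G x₀ w ξ (hlt k hk _ hk (Nat.lt_succ_self k))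
      ((h1 _ hk).trans (h2 k hk).symm)
  have hrun : ∀ k < a.K, _ := fun k hk => run_succ_of_accept a G x₀ w ξ
    ((h2 k hk).trans (congrArg (· + 1) (h1 k hk.le).symm))
  have hk' : ∀ k < a.K, (run a G x₀ w ξ (idx k)).k = k := fun k hk =>
    (run_control a G x₀ w ξ _).1.trans (h1 k hk.le)
  refine ⟨run_x_zero a G x₀ w ξ J, ?_, fun k hk => ?_, fun k hk => ?_, fun k hk => ?_⟩
  · rw [run_v_eq a G x₀ w ξ (Nat.zero_le _) (h1 0 (Nat.zero_le _))]
    rfl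
  · rw [hv k hk, hrun k hk]
    simp only [State.serve, State.update, hk' k hk]
  · have hJ : idx k + 1 ≤ J := by
      rw [← hK]
      exact hlt k hk _ le_rfl hk
    rw [hv k hk, run_x_eq a G x₀ w ξ hJ (h2 k hk).ge,
      run_x_eq a G x₀ w ξ (Nat.le_of_succ_le hJ) (h1 k hk.le).ge, hrun k hk]
    simp only [State.serve, State.update, hk' k hk, Function.update_self]
  · have hJ : idx k + 1 ≤ J := by
      rw [← hK]
      exact hlt k hk _ le_rfl hk
    refine ⟨(control a w (idx k)).2 (w (idx k)), ?_, ?_, ?_⟩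
    · simpa [h1 k hk.le] using control_stamp_le a w (idx k) (w (idx k))
    · by_contra hn
      have := h2 k hk
      rw [control_succ_fst, if_neg (by rw [h1 k hk.le]; exact fun h => hn h.2), h1 k hk.le] at this
      omega
    · rw [run_x_eq a G x₀ w ξ (Nat.le_of_succ_le hJ) (control_stamp_le a w _ _), run_point]

end Trajectory

/-! ### Smooth functions -/

section Smooth

variable {E : Type*} [NormedAddCommGroup E] [InnerProductSpace ℝ E] [CompleteSpace E]
  {f : E → ℝ} {L : ℝ}

/-- Along the segment, `f` minus its quadratic upper model has nonpositive derivative, by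
Cauchy-Schwarz and the Lipschitz bound. -/
theorem le_add_inner_gradient_add_sq (hf : Differentiable ℝ f)
    (hL : ∀ x y, ‖gradient f x - gradient f y‖ ≤ L * ‖x - y‖) (x y : E) :
    f y ≤ f x + inner ℝ (gradient f x) (y - x) + L / 2 * ‖y - x‖ ^ 2 := by
  set h := y - x with hh
  set φ : ℝ → ℝ := fun t =>
    f (x + t • h) - t * inner ℝ (gradient f x) h - L / 2 * t ^ 2 * ‖h‖ ^ 2 with hφ
  have hd : ∀ t, HasDerivAt φ (inner ℝ (gradient f (x + t • h)) h - inner ℝ (gradient f x) h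
      - L * t * ‖h‖ ^ 2) t := by
    intro t
    have h1 : HasDerivAt (fun t : ℝ => x + t • h) h t := by
      simpa using ((hasDerivAt_id t).smul_const h).const_add x
    have h2 := (hf (x + t • h)).hasFDerivAt.comp_hasDerivAt t h1
    rw [← inner_gradient_left] at h2
    have h3 : HasDerivAt (fun t : ℝ => t * inner ℝ (gradient f x) h)
        (inner ℝ (gradient f x) h) t := by
      simpa using (hasDerivAt_id t).mul_const (inner ℝ (gradient f x) h)
    have h4 : HasDerivAt (fun t : ℝ => L / 2 * t ^ 2 * ‖h‖ ^ 2) (L * t * ‖h‖ ^ 2) t := by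
      have := (((hasDerivAt_pow 2 t).const_mul (L / 2)).mul_const (‖h‖ ^ 2))
      exact this.congr_deriv (by push_cast; ring)
    exact (h2.sub h3).sub h4
  have hanti : AntitoneOn φ (Set.Ici 0) := by
    refine antitoneOn_of_deriv_nonpos (convex_Ici 0)
      (fun t _ => (hd t).continuousAt.continuousWithinAt)
      (fun t _ => (hd t).differentiableAt.differentiableWithinAt) fun t ht => ?_
    rw [interior_Ici, Set.mem_Ioi] at ht
    rw [(hd t).deriv, ← inner_sub_left]
    have h1 := real_inner_le_norm (gradient f (x + t • h) - gradient f x) h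
    have h2 := hL (x + t • h) x
    rw [add_sub_cancel_left, norm_smul, Real.norm_of_nonneg ht.le] at h2
    have h3 := mul_le_mul_of_nonneg_right h2 (norm_nonneg h)
    nlinarith
  have := hanti (Set.mem_Ici.2 le_rfl) (Set.mem_Ici.2 zero_le_one) zero_le_one
  have h0 : φ 0 = f x := by simp [hφ]
  have h1 : φ 1 = f y - inner ℝ (gradient f x) h - L / 2 * ‖h‖ ^ 2 := by
    rw [hφ]
    simp only [one_smul, one_mul, one_pow, mul_one, hh, add_sub_cancel]
  linarith

/-- A gradient step of size `1/L` lowers `f` by at least `‖∇f x‖² / (2L)`, and `f` cannot fall below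
`m`. -/
theorem norm_gradient_sq_le (hpos : 0 < L) (hf : Differentiable ℝ f)
    (hL : ∀ x y, ‖gradient f x - gradient f y‖ ≤ L * ‖x - y‖) {m : ℝ} (hm : ∀ x, m ≤ f x) (x : E) :
    ‖gradient f x‖ ^ 2 ≤ 2 * L * (f x - m) := by
  have h1 := le_add_inner_gradient_add_sq hf hL x (x - L⁻¹ • gradient f x)
  have h2 := hm (x - L⁻¹ • gradient f x)
  rw [sub_sub_cancel_left, inner_neg_right, norm_neg, inner_smul_right,
    real_inner_self_eq_norm_sq, norm_smul, Real.norm_of_nonneg (inv_nonneg.2 hpos.le)] at h1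
  have h3 : m ≤ f x - L⁻¹ / 2 * ‖gradient f x‖ ^ 2 := by
    refine h2.trans (h1.trans_eq ?_)
    field_simp
    ring
  have h4 : ‖gradient f x‖ ^ 2 = 2 * L * (L⁻¹ / 2 * ‖gradient f x‖ ^ 2) := by field_simp
  rw [h4]
  exact mul_le_mul_of_nonneg_left (by linarith) (by positivity)

/-- One normalized step, in a direction `v` of which `c • v` estimates the gradient. -/
theorem normalized_step_le (hf : Differentiable ℝ f)
    (hL : ∀ x y, ‖gradient f x - gradient f y‖ ≤ L * ‖x - y‖) (hL0 : 0 ≤ L) {η c : ℝ} (hη : 0 ≤ η)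
    (hc : 0 ≤ c) (x v : E) :
    f (x - η • (‖v‖⁻¹ • v)) ≤
      f x - η * ‖gradient f x‖ + 2 * η * ‖c • v - gradient f x‖ + L * η ^ 2 / 2 := by
  set u := ‖v‖⁻¹ • v with hu
  set e := c • v - gradient f x with he
  have hu1 : ‖u‖ ≤ 1 := by
    rw [hu, norm_smul, norm_inv, norm_norm]
    exact inv_mul_le_one
  have h1 := le_add_inner_gradient_add_sq hf hL x (x - η • u)
  rw [sub_sub_cancel_left, inner_neg_right, norm_neg, inner_smul_right, norm_smul,
    Real.norm_of_nonneg hη] at h1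
  have hg : gradient f x = c • v - e := by rw [he]; abel
  -- The direction `u` is aligned with `c • v`. The error `e` is then paid twice, once in the inner
  -- product and once in comparing norms.
  have h2 : inner ℝ (c • v) u = ‖c • v‖ := by
    rcases eq_or_ne v 0 with rfl | hv
    · simp
    · have := norm_ne_zero_iff.2 hv
      rw [hu, inner_smul_left, inner_smul_right, real_inner_self_eq_norm_sq, norm_smul,
        Real.norm_of_nonneg hc]
      simp only [conj_trivial]
      field_simp
  have h3 : inner ℝ e u ≤ ‖e‖ := by
    have := (real_inner_le_norm e u).trans (mul_le_mul_of_nonneg_left hu1 (norm_nonneg e))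
    linarith
  have h4 : ‖gradient f x‖ ≤ ‖c • v‖ + ‖e‖ := hg ▸ norm_sub_le _ _
  have h5 : ‖gradient f x‖ - 2 * ‖e‖ ≤ inner ℝ (gradient f x) u := by
    have : inner ℝ (gradient f x) u = ‖c • v‖ - inner ℝ e u := by
      conv_lhs => rw [hg]
      rw [inner_sub_left, h2]
    linarith
  have h6 : (η * ‖u‖) ^ 2 ≤ η ^ 2 := by
    rw [mul_pow]
    exact mul_le_of_le_one_right (sq_nonneg η) (pow_le_one₀ (norm_nonneg u) hu1)
  have h7 := mul_le_mul_of_nonneg_left h5 hη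
  have h8 := mul_le_mul_of_nonneg_left h6 (div_nonneg hL0 zero_le_two)
  linarith

end Smooth

/-! ### The momentum recursion -/

section Momentum

variable {E : Type*} [NormedAddCommGroup E] [NormedSpace ℝ E]

/-- The momentum vectors for the gradients `g 0, g 1, …`. -/
noncomputable def momentum (β : ℝ) (g : ℕ → E) : ℕ → E
  | 0 => 0
  | k + 1 => momentumWeight β k • momentum β g k + (1 - β) • g k

theorem momentum_add (β : ℝ) (g h : ℕ → E) (k : ℕ) :
    momentum β (fun k => g k + h k) k = momentum β g k + momentum β h k := by
  induction k with
  | zero => simp [momentum]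
  | succ k ih =>
    simp only [momentum, ih, smul_add]
    abel

theorem momentumWeight_nonneg {β : ℝ} (hβ : 0 ≤ β) (k : ℕ) : 0 ≤ momentumWeight β k := by
  rw [momentumWeight]
  split_ifs <;> simp [hβ]

theorem momentumWeight_le {β : ℝ} (hβ : 0 ≤ β) (k : ℕ) : momentumWeight β k ≤ β := by
  rw [momentumWeight]
  split_ifs <;> simp [hβ]

/-- The total weight of the gradients in the momentum vector. -/
noncomputable def totalWeight (β : ℝ) : ℕ → ℝ := momentum β fun _ => (1 : ℝ)

theorem totalWeight_succ (β : ℝ) (k : ℕ) :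
    totalWeight β (k + 1) = momentumWeight β k * totalWeight β k + (1 - β) := by
  simp [totalWeight, momentum]

/-- Since `β_1 = 0`, the second update erases the first gradient and the geometric sum restarts
there; the weights at indices 1 and 2 are both `1 - β`. -/
theorem totalWeight_add_two (β : ℝ) (k : ℕ) : totalWeight β (k + 2) = 1 - β ^ (k + 1) := by
  induction k with
  | zero => simp [totalWeight_succ, momentumWeight]
  | succ k ih =>
    rw [totalWeight_succ, ih, momentumWeight, if_neg (by omega)]
    ring

theorem totalWeight_one (β : ℝ) : totalWeight β 1 = 1 - β := by
  simp [totalWeight_succ, momentumWeight]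

theorem totalWeight_nonneg {β : ℝ} (h0 : 0 ≤ β) (h1 : β ≤ 1) (k : ℕ) : 0 ≤ totalWeight β k := by
  induction k with
  | zero => simp [totalWeight, momentum]
  | succ k ih =>
    rw [totalWeight_succ]
    have := mul_nonneg (momentumWeight_nonneg h0 k) ih
    linarith

theorem totalWeight_le_one {β : ℝ} (h0 : 0 ≤ β) (h1 : β ≤ 1) (k : ℕ) : totalWeight β k ≤ 1 := by
  induction k with
  | zero => simp [totalWeight, momentum]
  | succ k ih =>
    rw [totalWeight_succ]
    have := mul_le_mul (momentumWeight_le h0 k) ih (totalWeight_nonneg h0 h1 k) h0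
    linarith

theorem le_totalWeight_succ {β : ℝ} (h0 : 0 ≤ β) (h1 : β ≤ 1) (k : ℕ) :
    1 - β ≤ totalWeight β (k + 1) := by
  rw [totalWeight_succ]
  have := mul_nonneg (momentumWeight_nonneg h0 k) (totalWeight_nonneg h0 h1 k)
  linarith

end Momentum

/-! ### Averages of the inverse square roots of the total weights. -/

section TotalWeight

/-- One step of the telescoping bound for `∑ 1/√k`, equivalent to `2√(x-1)√x ≤ 2x - 1`. -/
theorem sqrt_le_sqrt_sub_one_add {x : ℝ} (hx : 1 ≤ x) : 2 * √(x - 1) + 1 / √x ≤ 2 * √x := by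
  have h0 : 0 < √x := Real.sqrt_pos.2 (by linarith)
  have h1 : √x * √x = x := Real.mul_self_sqrt (by linarith)
  have h2 : √(x - 1) * √(x - 1) = x - 1 := Real.mul_self_sqrt (by linarith)
  have h3 : 2 * √(x - 1) * √x ≤ 2 * x - 1 := by nlinarith [sq_nonneg (√x - √(x - 1))]
  have h4 : 2 * √(x - 1) + 1 / √x = (2 * √(x - 1) * √x + 1) / √x := by field_simp
  rw [h4, div_le_iff₀ h0]
  linarith

/-- With `t = αk`, Bernoulli gives `(1-α)^k ≤ (1+α)^(-k) ≤ 1/(1+t)`. Then `t/(1+t) ≥ t/(1+√t)²`. -/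
theorem inv_sqrt_one_sub_pow_le {α : ℝ} (h0 : 0 < α) (h1 : α ≤ 1) {k : ℕ} (hk : 1 ≤ k) :
    1 / √(1 - (1 - α) ^ k) ≤ 1 + 1 / √(α * k) := by
  have hk0 : (0 : ℝ) < k := by exact_mod_cast hk
  set t := α * k with ht
  have ht0 : 0 < t := by positivity
  have hpow : (1 - α) ^ k ≤ 1 / (1 + t) := by
    have h2 : 1 + k * α ≤ (1 + α) ^ k := one_add_mul_le_pow (by linarith) k
    have h3 : ((1 - α) * (1 + α)) ^ k ≤ 1 :=
      pow_le_one₀ (mul_nonneg (by linarith) (by linarith)) (by nlinarith)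
    rw [le_div_iff₀ (by positivity)]
    rw [mul_pow] at h3
    refine le_trans (mul_le_mul_of_nonneg_left ?_ (pow_nonneg (by linarith) k)) h3
    linarith
  have hlow : t / (1 + t) ≤ 1 - (1 - α) ^ k := by
    have : t / (1 + t) = 1 - 1 / (1 + t) := by field_simp; ring
    linarith
  have hs : 0 < √t := Real.sqrt_pos.2 ht0
  have hst : √t * √t = t := Real.mul_self_sqrt ht0.le
  have hD : √t / (1 + √t) ≤ √(1 - (1 - α) ^ k) := by
    apply Real.le_sqrt_of_sq_le
    refine le_trans ?_ hlow
    rw [div_pow, div_le_div_iff₀ (by positivity) (by positivity), sq, hst]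
    nlinarith
  calc 1 / √(1 - (1 - α) ^ k) ≤ 1 / (√t / (1 + √t)) :=
        one_div_le_one_div_of_le (by positivity) hD
    _ = 1 + 1 / √t := by
      field_simp
      ring

theorem sum_inv_sqrt_totalWeight_le {α : ℝ} (h0 : 0 < α) (h1 : α ≤ 1) {m : ℕ} (hm : 1 ≤ m) :
    ∑ k ∈ Finset.range (m + 1), 1 / √(totalWeight (1 - α) (k + 1)) ≤ (m + 1) + 2 * √(m / α) := by
  have hs : 0 < √α := Real.sqrt_pos.2 h0
  induction m, hm using Nat.le_induction with
  | base =>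
    rw [Finset.sum_range_succ, Finset.sum_range_one, totalWeight_one, totalWeight_add_two]
    simp only [zero_add, pow_one, sub_sub_cancel, Nat.cast_one]
    rw [Real.sqrt_div zero_le_one, Real.sqrt_one]
    linarith
  | succ m hm ih =>
    rw [Finset.sum_range_succ, totalWeight_add_two]
    have h2 := inv_sqrt_one_sub_pow_le h0 h1 (k := m + 1) (by omega)
    have h3 := sqrt_le_sqrt_sub_one_add (x := (m : ℝ) + 1) (by linarith [(m.cast_nonneg : (0 : ℝ) ≤ m)])
    rw [add_sub_cancel_right] at h3
    have h4 := div_le_div_of_nonneg_right h3 hs.le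
    have h5 : (2 * √(m : ℝ) + 1 / √((m : ℝ) + 1)) / √α =
        2 * √((m : ℝ) / α) + 1 / √(α * ((m : ℝ) + 1)) := by
      rw [Real.sqrt_div m.cast_nonneg, Real.sqrt_mul h0.le]
      field_simp
    have h6 : 2 * √((m : ℝ) + 1) / √α = 2 * √(((m : ℝ) + 1) / α) := by
      rw [Real.sqrt_div (by positivity)]
      ring
    rw [h5, h6] at h4
    push_cast at h2 ih ⊢
    linarith

/-- On average, the inverse square root of the total weight is at most `3/2`. -/
theorem sum_inv_sqrt_totalWeight_le_mul {α : ℝ} (h0 : 0 < α) (h1 : α ≤ 1) {K : ℕ}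
    (hK : 16 ≤ K * α) :
    ∑ k ∈ Finset.range K, 1 / √(totalWeight (1 - α) (k + 1)) ≤ 3 / 2 * K := by
  have hK16 : (16 : ℝ) ≤ K := hK.trans (mul_le_of_le_one_right K.cast_nonneg h1)
  obtain ⟨m, rfl⟩ : ∃ m, K = m + 1 := Nat.exists_eq_succ_of_ne_zero (by rintro rfl; norm_num at hK16)
  push_cast at hK hK16 ⊢
  have hm : 1 ≤ m := by
    have : (1 : ℝ) ≤ m := by linarith
    exact_mod_cast this
  refine (sum_inv_sqrt_totalWeight_le h0 h1 hm).trans ?_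
  -- From `16 ≤ (m+1)α` one gets `m/α ≤ ((m+1)/4)²`, so the excess `2√(m/α)` is at most half of `m +
  -- 1`.
  have h2 : √((m : ℝ) / α) ≤ ((m : ℝ) + 1) / 4 := by
    rw [Real.sqrt_le_left (by positivity), div_le_iff₀ h0]
    nlinarith
  linarith

end TotalWeight

/-! ### Trajectories -/

section Trajectory

variable {E : Type*} [NormedAddCommGroup E] [InnerProductSpace ℝ E]
  {f : E → ℝ} {L : ℝ} {a : Params} {x₀ : E} {x v y g : ℕ → E}

theorem IsTrajectory.v_eq (h : IsTrajectory a x₀ x v y g) {k : ℕ} (hk : k ≤ a.K) :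
    v k = momentum a.β g k := by
  induction k with
  | zero => exact h.v_zero
  | succ k ih => rw [h.v_succ k hk, ih (by omega), momentum]

theorem IsTrajectory.norm_sub_succ_le (h : IsTrajectory a x₀ x v y g) (hη : 0 ≤ a.η) {k : ℕ}
    (hk : k < a.K) : ‖x k - x (k + 1)‖ ≤ a.η := by
  rw [h.x_succ k hk, sub_sub_cancel, norm_smul, Real.norm_of_nonneg hη, norm_smul, norm_inv,
    norm_norm]
  exact mul_le_of_le_one_right hη inv_mul_le_one

theorem IsTrajectory.norm_sub_le (h : IsTrajectory a x₀ x v y g) (hη : 0 ≤ a.η) {m k : ℕ}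
    (hmk : m ≤ k) (hk : k ≤ a.K) : ‖x m - x k‖ ≤ a.η * (k - m) := by
  induction k, hmk using Nat.le_induction with
  | base => simp
  | succ k hmk ih =>
    have h1 := ih (by omega)
    have h2 := h.norm_sub_succ_le hη (k := k) hk
    have h3 := norm_sub_le_norm_sub_add_norm_sub (x m) (x k) (x (k + 1))
    push_cast
    linarith

variable [CompleteSpace E]

theorem IsTrajectory.norm_gradient_le (h : IsTrajectory a x₀ x v y g) (hη : 0 ≤ a.η) (hL0 : 0 ≤ L)
    (hL : ∀ x y, ‖gradient f x - gradient f y‖ ≤ L * ‖x - y‖) {k : ℕ} (hk : k ≤ a.K) :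
    ‖gradient f (x k)‖ ≤ ‖gradient f x₀‖ + L * (a.η * k) := by
  have h1 := h.norm_sub_le hη (Nat.zero_le k) hk
  rw [h.x_zero, norm_sub_rev, Nat.cast_zero, sub_zero] at h1
  have h2 := (hL (x k) x₀).trans (mul_le_mul_of_nonneg_left h1 hL0)
  have h3 := norm_le_norm_add_norm_sub (gradient f x₀) (gradient f (x k))
  rw [norm_sub_rev] at h3
  linarith

theorem IsTrajectory.norm_gradient_delayed_le (h : IsTrajectory a x₀ x v y g) (hη : 0 ≤ a.η)
    (hL0 : 0 ≤ L) (hL : ∀ x y, ‖gradient f x - gradient f y‖ ≤ L * ‖x - y‖) {k : ℕ}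
    (hk : k < a.K) : ‖gradient f (y k) - gradient f (x k)‖ ≤ L * a.η * (a.R - 1) := by
  obtain ⟨m, hm, hR, hy⟩ := h.delay k hk
  have h1 := h.norm_sub_le hη hm hk.le
  have h2 : (k : ℝ) - m ≤ a.R - 1 := by
    have : k + 1 ≤ a.R + m := by omega
    have : (k : ℝ) + 1 ≤ a.R + m := by exact_mod_cast this
    linarith
  rw [hy]
  refine (hL _ _).trans ?_
  rw [mul_assoc]
  exact mul_le_mul_of_nonneg_left (h1.trans (mul_le_mul_of_nonneg_left h2 hη)) hL0

/-- Passing to the next reference point costs at most `βLη`, and the new delayed gradient costs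
`(1-β)Lη(R-1)`. The constant `C = β/(1-β) + R - 1` solves `β + (1-β)(R-1) = (1-β)C`, so the bound
reproduces the recursion of the total weight. -/
theorem IsTrajectory.norm_momentum_gradient_sub_le (h : IsTrajectory a x₀ x v y g) (hη : 0 ≤ a.η)
    (hL0 : 0 ≤ L) (hL : ∀ x y, ‖gradient f x - gradient f y‖ ≤ L * ‖x - y‖) (hβ0 : 0 ≤ a.β)
    (hβ1 : a.β < 1) {k : ℕ} (hk : k < a.K) :
    ‖momentum a.β (fun k => gradient f (y k)) (k + 1) -
        totalWeight a.β (k + 1) • gradient f (x k)‖ ≤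
      L * a.η * (a.β / (1 - a.β) + (a.R - 1)) * totalWeight a.β (k + 1) := by
  have hα : 0 < 1 - a.β := by linarith
  have hLη : 0 ≤ L * a.η := mul_nonneg hL0 hη
  have hnew : ∀ k < a.K, ‖(1 - a.β) • (gradient f (y k) - gradient f (x k))‖ ≤
      (1 - a.β) * (L * a.η * (a.R - 1)) := fun k hk => by
    rw [norm_smul, Real.norm_of_nonneg hα.le]
    exact mul_le_mul_of_nonneg_left (h.norm_gradient_delayed_le hη hL0 hL hk) hα.le
  induction k with
  | zero =>
    have h1 := hnew 0 hk
    rw [totalWeight_one, momentum, momentum, smul_zero, zero_add, ← smul_sub]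
    refine h1.trans ?_
    have : L * a.η * (a.β / (1 - a.β) + (a.R - 1)) * (1 - a.β) =
        L * a.η * a.β + (1 - a.β) * (L * a.η * (a.R - 1)) := by field_simp
    rw [this]
    have := mul_nonneg hLη hβ0
    linarith
  | succ k ih =>
    set b := momentumWeight a.β (k + 1) with hb
    set W := totalWeight a.β (k + 1) with hW
    set S := momentum a.β (fun k => gradient f (y k)) (k + 1) with hS
    have hb0 : 0 ≤ b := momentumWeight_nonneg hβ0 _
    have hbβ : b ≤ a.β := momentumWeight_le hβ0 _
    have hW0 : 0 ≤ W := totalWeight_nonneg hβ0 hβ1.le _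
    have hW1 : W ≤ 1 := totalWeight_le_one hβ0 hβ1.le _
    have ih' := ih (by omega)
    have hsplit : momentum a.β (fun k => gradient f (y k)) (k + 1 + 1) -
        totalWeight a.β (k + 1 + 1) • gradient f (x (k + 1)) =
        b • (S - W • gradient f (x k)) +
          (b * W) • (gradient f (x k) - gradient f (x (k + 1))) +
          (1 - a.β) • (gradient f (y (k + 1)) - gradient f (x (k + 1))) := by
      rw [momentum, totalWeight_succ]
      module
    have h1 : ‖b • (S - W • gradient f (x k))‖ ≤
        b * (L * a.η * (a.β / (1 - a.β) + (a.R - 1)) * W) := by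
      rw [norm_smul, Real.norm_of_nonneg hb0]
      exact mul_le_mul_of_nonneg_left ih' hb0
    have h2 : ‖(b * W) • (gradient f (x k) - gradient f (x (k + 1)))‖ ≤ a.β * (L * a.η) := by
      rw [norm_smul, Real.norm_of_nonneg (mul_nonneg hb0 hW0)]
      refine mul_le_mul ?_ ((hL _ _).trans
        (mul_le_mul_of_nonneg_left (h.norm_sub_succ_le hη (by omega)) hL0)) (norm_nonneg _) hβ0
      exact (mul_le_of_le_one_right hb0 hW1).trans hbβ
    rw [hsplit]
    refine (norm_add₃_le.trans (add_le_add_three h1 h2 (hnew _ hk))).trans_eq ?_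
    rw [totalWeight_succ, ← hb, ← hW]
    field_simp
    ring

/-- The pathwise bound on the sum of the gradient norms. -/
theorem IsTrajectory.sum_norm_gradient_le (h : IsTrajectory a x₀ x v y g) (hη : 0 < a.η)
    (hL0 : 0 ≤ L) (hf : Differentiable ℝ f)
    (hL : ∀ x y, ‖gradient f x - gradient f y‖ ≤ L * ‖x - y‖) (hβ0 : 0 ≤ a.β) (hβ1 : a.β < 1)
    {m : ℝ} (hm : ∀ x, m ≤ f x) :
    ∑ k ∈ Finset.range a.K, ‖gradient f (x k)‖ ≤ (f x₀ - m) / a.η + a.K * (L * a.η / 2) +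
      2 * ∑ k ∈ Finset.range a.K,
        (‖momentum a.β (fun k => g k - gradient f (y k)) (k + 1)‖ / totalWeight a.β (k + 1) +
          L * a.η * (a.β / (1 - a.β) + (a.R - 1))) := by
  set N := momentum a.β (fun k => g k - gradient f (y k)) with hN
  set D := L * a.η * (a.β / (1 - a.β) + (a.R - 1)) with hD
  have hstep : ∀ k < a.K, a.η * ‖gradient f (x k)‖ ≤ f (x k) - f (x (k + 1)) +
      2 * a.η * (‖N (k + 1)‖ / totalWeight a.β (k + 1) + D) + L * a.η ^ 2 / 2 := by
    intro k hk
    set W := totalWeight a.β (k + 1) with hW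
    have hW0 : 0 < W := lt_of_lt_of_le (by linarith) (le_totalWeight_succ hβ0 hβ1.le k)
    -- The free scale `c` is taken to be `1/W`, which makes the momentum a weighted average.
    have h1 := normalized_step_le hf hL hL0 hη.le (inv_nonneg.2 hW0.le) (x k) (v (k + 1))
    rw [← h.x_succ k hk] at h1
    have hv : v (k + 1) = momentum a.β (fun k => gradient f (y k)) (k + 1) + N (k + 1) := by
      rw [h.v_eq hk, hN, ← momentum_add]
      simp
    have he : W⁻¹ • v (k + 1) - gradient f (x k) =
        W⁻¹ • (momentum a.β (fun k => gradient f (y k)) (k + 1) - W • gradient f (x k)) +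
          W⁻¹ • N (k + 1) := by
      rw [hv, smul_sub, smul_smul, inv_mul_cancel₀ hW0.ne', one_smul, smul_add]
      abel
    have hle : ‖W⁻¹ • v (k + 1) - gradient f (x k)‖ ≤ ‖N (k + 1)‖ / W + D := by
      rw [he]
      refine (norm_add_le _ _).trans ?_
      rw [norm_smul, norm_smul, Real.norm_of_nonneg (inv_nonneg.2 hW0.le), add_comm]
      refine add_le_add (by rw [inv_mul_eq_div]) ?_
      rw [inv_mul_le_iff₀ hW0, mul_comm W]
      exact h.norm_momentum_gradient_sub_le hη.le hL0 hL hβ0 hβ1 hk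
    have := mul_le_mul_of_nonneg_left hle (by positivity : 0 ≤ 2 * a.η)
    linarith
  have hsum := Finset.sum_le_sum fun k hk => hstep k (Finset.mem_range.1 hk)
  rw [← Finset.mul_sum, Finset.sum_add_distrib, Finset.sum_add_distrib, Finset.sum_range_sub',
    ← Finset.mul_sum, Finset.sum_const, Finset.card_range, nsmul_eq_mul, h.x_zero] at hsum
  have h2 := hm (x a.K)
  rw [← mul_le_mul_iff_right₀ hη]
  refine hsum.trans ?_
  have h3 : a.η * ((f x₀ - m) / a.η) = f x₀ - m := by field_simp
  rw [mul_add, mul_add, h3]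
  nlinarith

end Trajectory

/-! ### Moments of order `p` of the noise -/

section Pointwise

/-- Scalar form of `norm_add_rpow_le`, with `a = ⟨x,y⟩/‖x‖²` and `b = ‖y‖/‖x‖`. Bernoulli for the
concave power `p/2` is applied around `1` if `b ≤ 1`, and around `b²` if `b > 1`. -/
theorem one_add_rpow_half_le {p : ℝ} (hp1 : 1 < p) (hp2 : p ≤ 2) {a b : ℝ} (hb : 0 ≤ b)
    (ha : -b ≤ a) : (1 + 2 * a + b ^ 2) ^ (p / 2) ≤ 1 + p * a + 2 * b ^ p := by
  rcases le_or_gt b 1 with h1 | h1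
  · have h2 := rpow_one_add_le_one_add_mul_self (s := 2 * a + b ^ 2)
      (by nlinarith [sq_nonneg (b - 1)]) (p := p / 2) (by linarith) (by linarith)
    have h3 : b ^ 2 ≤ b ^ p := by
      rw [← Real.rpow_natCast]
      exact Real.rpow_le_rpow_of_exponent_ge' hb h1 (by linarith) (by exact_mod_cast hp2)
    have h4 : 0 ≤ b ^ 2 := sq_nonneg b
    rw [add_assoc]
    nlinarith
  · have hb0 : 0 < b := by linarith
    set B := b ^ (p - 2) with hB
    have hB0 : 0 < B := Real.rpow_pos_of_pos hb0 _
    have hB1 : B ≤ 1 := Real.rpow_le_one_of_one_le_of_nonpos h1.le (by linarith)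
    have hBp : b ^ p = B * b ^ 2 := by
      rw [hB, ← Real.rpow_natCast, ← Real.rpow_add hb0]
      norm_num
    have hBinv : B * b ^ (2 - p) = 1 := by
      rw [hB, ← Real.rpow_add hb0]
      norm_num
    have h2 := rpow_one_add_le_one_add_mul_self (s := b - 1) (by linarith) (p := 2 - p)
      (by linarith) (by linarith)
    rw [add_sub_cancel] at h2
    -- This is the inequality needed at the worst value `a = -b`; it follows from Bernoulli for
    -- `b^(2-p)` and `p(2-p) ≤ 1`.
    have h3 : p ≤ B * (b + p) := by
      have h4 := mul_le_mul_of_nonneg_left h2 (by positivity : 0 ≤ B * p)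
      have h5 : B * p * b ^ (2 - p) = p := by rw [mul_right_comm, hBinv, one_mul]
      rw [h5] at h4
      refine h4.trans ?_
      rw [mul_assoc]
      refine mul_le_mul_of_nonneg_left ?_ hB0.le
      nlinarith [sq_nonneg (p - 1)]
    have hw : -1 ≤ (1 + 2 * a) / b ^ 2 := by
      rw [le_div_iff₀ (by positivity)]
      nlinarith [sq_nonneg (b - 1)]
    have h4 := rpow_one_add_le_one_add_mul_self hw (p := p / 2) (by linarith) (by linarith)
    have h5 : (1 + 2 * a + b ^ 2) ^ (p / 2) = B * b ^ 2 * (1 + (1 + 2 * a) / b ^ 2) ^ (p / 2) := by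
      have : 1 + 2 * a + b ^ 2 = b ^ 2 * (1 + (1 + 2 * a) / b ^ 2) := by
        field_simp
        ring
      rw [this, Real.mul_rpow (by positivity) (by linarith), ← hBp, ← Real.rpow_natCast,
        ← Real.rpow_mul hb]
      congr 2
      push_cast
      ring
    rw [h5, hBp]
    refine (mul_le_mul_of_nonneg_left h4 (by positivity)).trans ?_
    have h6 : B * b ^ 2 * (1 + p / 2 * ((1 + 2 * a) / b ^ 2)) =
        B * b ^ 2 + p / 2 * B * (1 + 2 * a) := by field_simp
    rw [h6]
    have h7 : 0 ≤ (a + b) * (p * (1 - B)) :=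
      mul_nonneg (by linarith) (mul_nonneg (by linarith) (by linarith))
    have h8 : 0 ≤ b * (B * (b + p) - p) := mul_nonneg hb (by linarith)
    have h9 : p / 2 * B ≤ 1 := by nlinarith
    nlinarith

/-- Substitute for expanding a square when `p < 2`: the middle term is linear in `y`, so it has mean
zero for centred `y` independent of `x`. -/
theorem norm_add_rpow_le {E : Type*} [NormedAddCommGroup E] [InnerProductSpace ℝ E] {p : ℝ}
    (hp1 : 1 < p) (hp2 : p ≤ 2) (x y : E) :
    ‖x + y‖ ^ p ≤ ‖x‖ ^ p + p * (‖x‖ ^ (p - 2) * inner ℝ x y) + 2 * ‖y‖ ^ p := by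
  rcases eq_or_ne x 0 with rfl | hx
  · have : 0 ≤ ‖y‖ ^ p := by positivity
    simp only [zero_add, inner_zero_left, mul_zero, add_zero, norm_zero,
      Real.zero_rpow (by linarith : p ≠ 0)]
    linarith
  · set s := ‖x‖ with hs
    have hs0 : 0 < s := norm_pos_iff.2 hx
    have hc : -(‖y‖ / s) ≤ inner ℝ x y / s ^ 2 := by
      rw [le_div_iff₀ (by positivity)]
      have := (abs_le.1 (abs_real_inner_le_norm x y)).1
      have h2 : -(‖y‖ / s) * s ^ 2 = -(s * ‖y‖) := by field_simp
      rw [h2]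
      exact this
    have h1 := one_add_rpow_half_le hp1 hp2 (by positivity) hc
    have h2 : 1 + 2 * (inner ℝ x y / s ^ 2) + (‖y‖ / s) ^ 2 = (‖x + y‖ / s) ^ 2 := by
      rw [div_pow, div_pow, norm_add_sq_real, ← hs]
      field_simp
    have h3 : ((‖x + y‖ / s) ^ 2) ^ (p / 2) = ‖x + y‖ ^ p / s ^ p := by
      rw [← Real.rpow_natCast, ← Real.rpow_mul (by positivity),
        ← Real.div_rpow (norm_nonneg _) hs0.le]
      congr 1
      push_cast
      ring
    have h4 : s ^ (p - 2) = s ^ p / s ^ 2 := by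
      rw [Real.rpow_sub hs0]
      norm_num
    have hsp : 0 < s ^ p := Real.rpow_pos_of_pos hs0 _
    rw [h2, h3, Real.div_rpow (norm_nonneg _) hs0.le, div_le_iff₀ hsp] at h1
    refine h1.trans_eq ?_
    rw [h4]
    field_simp

/-- Jensen's inequality through the tangent to `t ↦ t^p` at `t = c`, which also yields
integrability. -/
theorem integral_le_of_integral_rpow_le {Ω : Type*} [MeasurableSpace Ω] {Q : Measure Ω}
    [IsProbabilityMeasure Q] {p c : ℝ} (hp : 1 ≤ p) (hc : 0 < c) {h : Ω → ℝ} (h0 : ∀ ω, 0 ≤ h ω)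
    (hint : Integrable (fun ω => h ω ^ p) Q) (hmeas : AEStronglyMeasurable h Q)
    (hle : ∫ ω, h ω ^ p ∂Q ≤ c ^ p) : Integrable h Q ∧ ∫ ω, h ω ∂Q ≤ c := by
  have hp0 : 0 < p := by linarith
  have hcp : 0 < c ^ p := Real.rpow_pos_of_pos hc _
  have hpt : ∀ ω, h ω ≤ c * (1 - 1 / p) + c / p / c ^ p * h ω ^ p := by
    intro ω
    have h1 := one_add_mul_self_le_rpow_one_add (s := h ω / c - 1)
      (by linarith [div_nonneg (h0 ω) hc.le]) hp
    rw [add_sub_cancel, Real.div_rpow (h0 ω) hc.le] at h1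
    have h2 : h ω / c ≤ 1 - 1 / p + 1 / p * (h ω ^ p / c ^ p) := by
      have : h ω / c = 1 - 1 / p + 1 / p * (1 + p * (h ω / c - 1)) := by
        field_simp
        ring
      rw [this]
      gcongr
    have h3 := mul_le_mul_of_nonneg_left h2 hc.le
    rw [mul_div_cancel₀ _ hc.ne'] at h3
    refine h3.trans_eq ?_
    ring
  have hint' : Integrable (fun ω => c * (1 - 1 / p) + c / p / c ^ p * h ω ^ p) Q :=
    (integrable_const _).add (hint.const_mul _)
  have hInt : Integrable h Q := hint'.mono' hmeas (Filter.Eventually.of_forall fun ω => by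
    rw [Real.norm_of_nonneg (h0 ω)]
    exact hpt ω)
  refine ⟨hInt, (integral_mono hInt hint' hpt).trans ?_⟩
  rw [integral_add (integrable_const _) (hint.const_mul _), integral_const_mul (c / p / c ^ p),
    integral_const]
  simp only [probReal_univ, one_smul]
  have h2 : c / p / c ^ p * ∫ ω, h ω ^ p ∂Q ≤ c / p / c ^ p * c ^ p :=
    mul_le_mul_of_nonneg_left hle (by positivity)
  have h3 : c * (1 - 1 / p) + c / p / c ^ p * c ^ p = c := by
    field_simp
    ring
  linarith

end Pointwise

/-! ### Oracle noise at a random point with a fresh sample. -/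

section Oracle

variable {d : ℕ} {Ξ Ω : Type*} [MeasurableSpace Ξ] {D : Measure Ξ}
  {f : EuclideanSpace ℝ (Fin d) → ℝ}
  {G : EuclideanSpace ℝ (Fin d) → Ξ → EuclideanSpace ℝ (Fin d)} {L p σ : ℝ}

theorem IsSmoothObjective.continuous_gradient (hf : IsSmoothObjective f L) :
    Continuous (gradient f) :=
  (LipschitzWith.of_dist_le_mul (K := ⟨L, hf.pos.le⟩) fun x y => by
    rw [dist_eq_norm, dist_eq_norm]
    exact hf.lipschitz x y).continuous

theorem IsSmoothObjective.measurable_noise (hf : IsSmoothObjective f L)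
    (hG : IsBCMOracle D f G p σ) {β : Type*} {mβ : MeasurableSpace β}
    {y : β → EuclideanSpace ℝ (Fin d)} {ζ : β → Ξ} (hy : Measurable y) (hζ : Measurable ζ) :
    Measurable fun ω => G (y ω) (ζ ω) - gradient f (y ω) :=
  (hG.measurable.comp (hy.prodMk hζ)).sub (hf.continuous_gradient.measurable.comp hy)

theorem map_prodMk_eq_prod {β : Type*} {mβ : MeasurableSpace β} {m mΩ : MeasurableSpace Ω}
    {Q : Measure Ω} [IsProbabilityMeasure Q] {ζ : Ω → Ξ} (hm : m ≤ mΩ)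
    (hind : Indep m (MeasurableSpace.comap ζ inferInstance) Q) (hζ : Measurable ζ)
    (hlaw : Q.map ζ = D) {A : Ω → β} (hA : Measurable[m] A) :
    Q.map (fun ω => (A ω, ζ ω)) = (Q.map A).prod D := by
  have h1 : IndepFun A ζ Q := indep_of_indep_of_le_left hind hA.comap_le
  rw [(indepFun_iff_map_prod_eq_prod_map_map (hA.mono hm le_rfl).aemeasurable
    hζ.aemeasurable).1 h1, hlaw]

variable [IsProbabilityMeasure D]

/-- A crude bound uniform in `x`, used only for integrability on the product space. -/
theorem IsBCMOracle.integral_norm_noise_le (hG : IsBCMOracle D f G p σ) (hp : 1 ≤ p)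
    (x : EuclideanSpace ℝ (Fin d)) : ∫ z, ‖G x z - gradient f x‖ ∂D ≤ 1 + σ ^ p := by
  have h1 : ∀ z, ‖G x z - gradient f x‖ ≤ 1 + ‖G x z - gradient f x‖ ^ p := by
    intro z
    rcases le_total ‖G x z - gradient f x‖ 1 with h | h
    · have : 0 ≤ ‖G x z - gradient f x‖ ^ p := by positivity
      linarith
    · have := Real.self_le_rpow_of_one_le h hp
      linarith
  have h2 : Integrable (fun z => 1 + ‖G x z - gradient f x‖ ^ p) D :=
    (integrable_const _).add (hG.integrable_moment x)
  refine (integral_mono ((hG.integrable x).sub (integrable_const _)).norm h2 h1).trans ?_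
  rw [integral_add (integrable_const _) (hG.integrable_moment x)]
  simpa using hG.moment_le x

variable {m mΩ : MeasurableSpace Ω} {Q : Measure Ω} [IsProbabilityMeasure Q] {ζ : Ω → Ξ}

/-- The point is known before the sample is drawn, so their joint law is a product; by Fubini the
oracle bound applies at each frozen point. -/
theorem IsBCMOracle.integral_noise_rpow_le (hf : IsSmoothObjective f L)
    (hG : IsBCMOracle D f G p σ) (hm : m ≤ mΩ)
    (hind : Indep m (MeasurableSpace.comap ζ inferInstance) Q) (hζ : Measurable ζ)
    (hlaw : Q.map ζ = D) {y : Ω → EuclideanSpace ℝ (Fin d)} (hy : Measurable[m] y) :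
    Integrable (fun ω => ‖G (y ω) (ζ ω) - gradient f (y ω)‖ ^ p) Q ∧
      ∫ ω, ‖G (y ω) (ζ ω) - gradient f (y ω)‖ ^ p ∂Q ≤ σ ^ p := by
  have hy' : Measurable y := hy.mono hm le_rfl
  have hmap := map_prodMk_eq_prod hm hind hζ hlaw hy
  have hpair : Measurable fun ω => (y ω, ζ ω) := hy'.prodMk hζ
  have : IsProbabilityMeasure (Q.map y) := Measure.isProbabilityMeasure_map hy'.aemeasurable
  set h : EuclideanSpace ℝ (Fin d) × Ξ → ℝ := fun q => ‖G q.1 q.2 - gradient f q.1‖ ^ p with hh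
  have hmeas : Measurable h :=
    (hf.measurable_noise hG measurable_fst measurable_snd).norm.pow_const p
  have hint : Integrable h ((Q.map y).prod D) := by
    rw [integrable_prod_iff hmeas.aestronglyMeasurable]
    refine ⟨Filter.Eventually.of_forall fun x => hG.integrable_moment x, ?_⟩
    refine Integrable.of_bound hmeas.aestronglyMeasurable.norm.integral_prod_right' (σ ^ p)
      (Filter.Eventually.of_forall fun x => ?_)
    have h0 : ∀ z, ‖h (x, z)‖ = ‖G x z - gradient f x‖ ^ p := fun z =>
      Real.norm_of_nonneg (by positivity)
    simp only [h0]
    rw [Real.norm_of_nonneg (integral_nonneg fun z => by positivity)]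
    exact hG.moment_le x
  constructor
  · rw [← hmap] at hint
    exact hint.comp_measurable hpair
  · have h1 : ∫ ω, ‖G (y ω) (ζ ω) - gradient f (y ω)‖ ^ p ∂Q = ∫ q, h q ∂(Q.map y).prod D := by
      rw [← hmap, integral_map hpair.aemeasurable hmeas.aestronglyMeasurable]
    rw [h1, integral_prod _ hint]
    refine (integral_mono hint.integral_prod_left (integrable_const (σ ^ p))
      fun x => hG.moment_le x).trans ?_
    simp

/-- With the past pair `(A, y)` frozen, the integral over the sample vanishes by unbiasedness. -/
theorem IsBCMOracle.integral_inner_noise_eq_zero (hf : IsSmoothObjective f L)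
    (hG : IsBCMOracle D f G p σ) (hp : 1 ≤ p) (hm : m ≤ mΩ)
    (hind : Indep m (MeasurableSpace.comap ζ inferInstance) Q) (hζ : Measurable ζ)
    (hlaw : Q.map ζ = D) {A y : Ω → EuclideanSpace ℝ (Fin d)} (hA : Measurable[m] A)
    (hy : Measurable[m] y) (hAint : Integrable A Q) :
    Integrable (fun ω => inner ℝ (A ω) (G (y ω) (ζ ω) - gradient f (y ω))) Q ∧
      ∫ ω, inner ℝ (A ω) (G (y ω) (ζ ω) - gradient f (y ω)) ∂Q = 0 := by
  set B : Ω → EuclideanSpace ℝ (Fin d) × EuclideanSpace ℝ (Fin d) := fun ω => (A ω, y ω) with hB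
  have hBm : Measurable[m] B := hA.prodMk hy
  have hB' : Measurable B := hBm.mono hm le_rfl
  have hmap := map_prodMk_eq_prod hm hind hζ hlaw hBm
  have hpair : Measurable fun ω => (B ω, ζ ω) := hB'.prodMk hζ
  have : IsProbabilityMeasure (Q.map B) := Measure.isProbabilityMeasure_map hB'.aemeasurable
  set h : (EuclideanSpace ℝ (Fin d) × EuclideanSpace ℝ (Fin d)) × Ξ → ℝ :=
    fun q => inner ℝ q.1.1 (G q.1.2 q.2 - gradient f q.1.2) with hh
  have hmeas : Measurable h := (measurable_fst.comp measurable_fst).inner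
    (hf.measurable_noise hG (measurable_snd.comp measurable_fst) measurable_snd)
  have hsec : ∀ b, Integrable (fun z => G b z - gradient f b) D := fun b =>
    (hG.integrable b).sub (integrable_const _)
  have hint : Integrable h ((Q.map B).prod D) := by
    rw [integrable_prod_iff hmeas.aestronglyMeasurable]
    refine ⟨Filter.Eventually.of_forall fun b => (hsec b.2).const_inner b.1, ?_⟩
    have hAmap : Integrable (fun b : EuclideanSpace ℝ (Fin d) × EuclideanSpace ℝ (Fin d) =>
        ‖b.1‖ * (1 + σ ^ p)) (Q.map B) := by
      refine Integrable.mul_const ?_ _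
      rw [integrable_map_measure (measurable_fst.norm.aestronglyMeasurable) hB'.aemeasurable]
      exact hAint.norm
    refine hAmap.mono' hmeas.aestronglyMeasurable.norm.integral_prod_right'
      (Filter.Eventually.of_forall fun b => ?_)
    rw [Real.norm_of_nonneg (integral_nonneg fun z => norm_nonneg _)]
    have h1 : ∫ z, ‖h (b, z)‖ ∂D ≤ ∫ z, ‖b.1‖ * ‖G b.2 z - gradient f b.2‖ ∂D :=
      integral_mono ((hsec b.2).const_inner b.1).norm ((hsec b.2).norm.const_mul _)
        fun z => norm_inner_le_norm _ _
    refine h1.trans ?_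
    rw [integral_const_mul]
    exact mul_le_mul_of_nonneg_left (hG.integral_norm_noise_le hp b.2) (norm_nonneg _)
  constructor
  · rw [← hmap] at hint
    exact hint.comp_measurable hpair
  · have h1 : ∫ ω, inner ℝ (A ω) (G (y ω) (ζ ω) - gradient f (y ω)) ∂Q =
        ∫ q, h q ∂(Q.map B).prod D := by
      rw [← hmap, integral_map hpair.aemeasurable hmeas.aestronglyMeasurable]
    rw [h1, integral_prod _ hint]
    have h2 : ∀ b, ∫ z, h (b, z) ∂D = 0 := fun b => by
      rw [hh]
      simp only
      rw [integral_inner (hsec b.2), integral_sub (hG.integrable _) (integrable_const _),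
        hG.unbiased]
      simp
    simp [h2]

end Oracle

/-! ### Moments of the accumulated noise. -/

section NoiseMomentum

variable {d : ℕ} {Ξ Ω : Type*} [MeasurableSpace Ξ] {D : Measure Ξ} [IsProbabilityMeasure D]
  {f : EuclideanSpace ℝ (Fin d) → ℝ}
  {G : EuclideanSpace ℝ (Fin d) → Ξ → EuclideanSpace ℝ (Fin d)} {L p σ : ℝ}
  [mΩ : MeasurableSpace Ω] {Q : Measure Ω} [IsProbabilityMeasure Q] {ζ : ℕ → Ω → Ξ}

/-- The `p`-th moment of the accumulated noise, by the martingale property. -/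
theorem integral_norm_momentum_noise_rpow_le (hf : IsSmoothObjective f L)
    (hG : IsBCMOracle D f G p σ) (hp1 : 1 < p) (hp2 : p ≤ 2) {β : ℝ} (hβ0 : 0 ≤ β)
    (hβ1 : β < 1) {K : ℕ} {ℱ : ℕ → MeasurableSpace Ω} (hle : ∀ k, ℱ k ≤ mΩ)
    (hmono : ∀ k < K, ℱ k ≤ ℱ (k + 1))
    (hind : ∀ k < K, Indep (ℱ k) (MeasurableSpace.comap (ζ k) inferInstance) Q)
    (hζ : ∀ k < K, Measurable[ℱ (k + 1)] (ζ k)) (hlaw : ∀ k < K, Q.map (ζ k) = D)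
    {y : ℕ → Ω → EuclideanSpace ℝ (Fin d)} (hy : ∀ k < K, Measurable[ℱ k] (y k)) {k : ℕ}
    (hk : k ≤ K) :
    Measurable[ℱ k] (fun ω =>
        momentum β (fun l => G (y l ω) (ζ l ω) - gradient f (y l ω)) k) ∧
      Integrable (fun ω =>
        ‖momentum β (fun l => G (y l ω) (ζ l ω) - gradient f (y l ω)) k‖ ^ p) Q ∧
      ∫ ω, ‖momentum β (fun l => G (y l ω) (ζ l ω) - gradient f (y l ω)) k‖ ^ p ∂Q ≤
        2 * σ ^ p * (1 - β) ^ (p - 1) * totalWeight β k := by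
  have hp0 : p ≠ 0 := by linarith
  induction k with
  | zero => simp [momentum, totalWeight, Real.zero_rpow hp0]
  | succ k ih =>
    obtain ⟨ih1, ih2, ih3⟩ := ih (by omega)
    have hk' : k < K := hk
    set N : Ω → EuclideanSpace ℝ (Fin d) := fun ω =>
      momentum β (fun l => G (y l ω) (ζ l ω) - gradient f (y l ω)) k with hN
    set e : Ω → EuclideanSpace ℝ (Fin d) := fun ω =>
      G (y k ω) (ζ k ω) - gradient f (y k ω) with he
    set b := momentumWeight β k with hb
    set α := 1 - β with hα
    have hα0 : 0 < α := by linarith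
    have hb0 : 0 ≤ b := momentumWeight_nonneg hβ0 k
    have hb1 : b ≤ 1 := (momentumWeight_le hβ0 k).trans hβ1.le
    have hsucc : ∀ ω, momentum β (fun l => G (y l ω) (ζ l ω) - gradient f (y l ω)) (k + 1) =
        b • N ω + α • e ω := fun ω => rfl
    simp only [hsucc]
    have hmeas : Measurable[ℱ (k + 1)] fun ω => b • N ω + α • e ω := by
      have h1 : Measurable[ℱ (k + 1)] N := ih1.mono (hmono k hk') le_rfl
      have h2 : Measurable[ℱ (k + 1)] e :=
        hf.measurable_noise hG ((hy k hk').mono (hmono k hk') le_rfl) (hζ k hk')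
      exact (h1.const_smul b).add (h2.const_smul α)
    have hζ' : Measurable (ζ k) := (hζ k hk').mono (hle _) le_rfl
    -- The factor paired with the new noise in the cross term of `norm_add_rpow_le`. It depends on
    -- the past only, and its norm is at most `pα(1 + ‖b • N‖^p)`.
    set A : Ω → EuclideanSpace ℝ (Fin d) := fun ω =>
      (p * α * ‖b • N ω‖ ^ (p - 2)) • (b • N ω) with hA
    have hφ : Measurable fun u : EuclideanSpace ℝ (Fin d) => (p * α * ‖u‖ ^ (p - 2)) • u := by
      fun_prop
    have hAm : Measurable[ℱ k] A := hφ.comp (ih1.const_smul b)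
    have hbN : Integrable (fun ω => ‖b • N ω‖ ^ p) Q := by
      simp only [norm_smul, Real.mul_rpow (norm_nonneg _) (norm_nonneg _)]
      exact ih2.const_mul _
    have hAint : Integrable A Q := by
      have h1 : Integrable (fun ω => p * α * (1 + ‖b • N ω‖ ^ p)) Q :=
        ((integrable_const _).add hbN).const_mul _
      refine h1.mono' (hAm.mono (hle k) le_rfl).aestronglyMeasurable
        (Filter.Eventually.of_forall fun ω => ?_)
      have hpα : 0 ≤ p * α := by nlinarith
      rw [hA]
      simp only
      rw [norm_smul, Real.norm_of_nonneg (by positivity), mul_assoc]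
      refine mul_le_mul_of_nonneg_left ?_ hpα
      rcases eq_or_ne (b • N ω) 0 with h0 | h0
      · rw [h0, norm_zero, mul_zero, Real.zero_rpow hp0]
        norm_num
      · have hn : 0 < ‖b • N ω‖ := norm_pos_iff.2 h0
        have h2 : ‖b • N ω‖ ^ (p - 2) * ‖b • N ω‖ = ‖b • N ω‖ ^ (p - 1) := by
          rw [← Real.rpow_add_one hn.ne']
          congr 1
          ring
        rw [h2]
        have hp' : 0 ≤ ‖b • N ω‖ ^ p := by positivity
        rcases le_total ‖b • N ω‖ 1 with h1 | h1
        · have := Real.rpow_le_one hn.le h1 (by linarith : 0 ≤ p - 1)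
          linarith
        · have := Real.rpow_le_rpow_of_exponent_le h1 (by linarith : p - 1 ≤ p)
          linarith
    obtain ⟨hc1, hc2⟩ := hG.integral_inner_noise_eq_zero hf hp1.le (hle k) (hind k hk') hζ'
      (hlaw k hk') hAm (hy k hk') hAint
    obtain ⟨hm1, hm2⟩ := hG.integral_noise_rpow_le hf (hle k) (hind k hk') hζ'
      (hlaw k hk') (hy k hk')
    have hpt : ∀ ω, ‖b • N ω + α • e ω‖ ^ p ≤
        b * ‖N ω‖ ^ p + inner ℝ (A ω) (e ω) + 2 * α ^ p * ‖e ω‖ ^ p := by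
      intro ω
      refine (norm_add_rpow_le hp1 hp2 (b • N ω) (α • e ω)).trans ?_
      -- Weakening `b^p` to `b` lets the moments follow the recursion of `totalWeight`; writing
      -- `α^p` as `α^(p-1) α` then closes the induction.
      have h1 : ‖b • N ω‖ ^ p ≤ b * ‖N ω‖ ^ p := by
        rw [norm_smul, Real.norm_of_nonneg hb0, Real.mul_rpow hb0 (norm_nonneg _)]
        refine mul_le_mul_of_nonneg_right ?_ (by positivity)
        simpa using Real.rpow_le_rpow_of_exponent_ge' hb0 hb1 zero_le_one hp1.le
      have h2 : p * (‖b • N ω‖ ^ (p - 2) * inner ℝ (b • N ω) (α • e ω)) = inner ℝ (A ω) (e ω) := by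
        rw [hA]
        simp only [inner_smul_left, inner_smul_right, conj_trivial]
        ring
      have h3 : ‖α • e ω‖ ^ p = α ^ p * ‖e ω‖ ^ p := by
        rw [norm_smul, Real.norm_of_nonneg hα0.le, Real.mul_rpow hα0.le (norm_nonneg _)]
      rw [h2, h3]
      linarith
    have hint₁ : Integrable (fun ω => b * ‖N ω‖ ^ p + inner ℝ (A ω) (e ω)) Q :=
      (ih2.const_mul b).add hc1
    have hint₂ : Integrable (fun ω => 2 * α ^ p * ‖e ω‖ ^ p) Q := hm1.const_mul _
    have hint' : Integrable (fun ω =>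
        b * ‖N ω‖ ^ p + inner ℝ (A ω) (e ω) + 2 * α ^ p * ‖e ω‖ ^ p) Q := hint₁.add hint₂
    have hint : Integrable (fun ω => ‖b • N ω + α • e ω‖ ^ p) Q :=
      hint'.mono' ((hmeas.mono (hle _) le_rfl).norm.pow_const p).aestronglyMeasurable
        (Filter.Eventually.of_forall fun ω => by
          rw [Real.norm_of_nonneg (by positivity)]
          exact hpt ω)
    refine ⟨hmeas, hint, (integral_mono hint hint' hpt).trans ?_⟩
    rw [integral_add hint₁ hint₂, integral_add (ih2.const_mul b) hc1, hc2, integral_const_mul,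
      integral_const_mul, totalWeight_succ]
    have hαp : α ^ p = α ^ (p - 1) * α := by
      rw [← Real.rpow_add_one hα0.ne']
      congr 1
      ring
    have h1 := mul_le_mul_of_nonneg_left ih3 hb0
    have h2 := mul_le_mul_of_nonneg_left hm2 (by positivity : 0 ≤ 2 * α ^ p)
    rw [hαp] at h2 ⊢
    linarith

end NoiseMomentum

/-! ### The information carried by the received gradients -/

section History

variable {n : ℕ} {Ξ : Type*} [MeasurableSpace Ξ]

/-- The σ-algebra generated by the samples behind the first `j` received gradients. -/
abbrev history (Ξ : Type*) [MeasurableSpace Ξ] (w : ℕ → Fin n) (j : ℕ) :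
    MeasurableSpace (Fin n × ℕ → Ξ) :=
  MeasurableSpace.comap
    (fun (z : Fin n × ℕ → Ξ) (l : Finset.range j) => z (w l, received w l (w l))) inferInstance

variable (w : ℕ → Fin n)

theorem history_le (j : ℕ) : history Ξ w j ≤ MeasurableSpace.pi :=
  Measurable.comap_le (measurable_pi_lambda _ fun _ => measurable_pi_apply _)

theorem measurable_sample {l j : ℕ} (h : l < j) :
    Measurable[history Ξ w j] fun z : Fin n × ℕ → Ξ => z (w l, received w l (w l)) := by
  have h1 : Measurable[history Ξ w j]
      fun (z : Fin n × ℕ → Ξ) (l : Finset.range j) => z (w l, received w l (w l)) :=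
    comap_measurable _
  exact (measurable_pi_apply (⟨l, Finset.mem_range.2 h⟩ : Finset.range j)).comp h1

theorem history_mono : Monotone (history Ξ w) := by
  intro j j' h
  refine Measurable.comap_le ?_
  exact @measurable_pi_lambda _ _ _ (history Ξ w j') _ _ fun l =>
    measurable_sample w ((Finset.mem_range.1 l.2).trans_le h)

/-- By `injective_sampleIndex`, the `j`-th gradient uses a coordinate that none of the earlier ones
used. -/
theorem indep_history (D : Measure Ξ) [IsProbabilityMeasure D] (j : ℕ) :
    Indep (history Ξ w j) (MeasurableSpace.comap
      (fun z : Fin n × ℕ → Ξ => z (w j, received w j (w j))) inferInstance)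
      (Measure.infinitePi fun _ : Fin n × ℕ => D) := by
  have h1 : iIndepFun (fun (q : Fin n × ℕ) (z : Fin n × ℕ → Ξ) => z q)
      (Measure.infinitePi fun _ : Fin n × ℕ => D) :=
    iIndepFun_infinitePi (X := fun _ => id) fun _ => measurable_id
  have h2 := h1.precomp (injective_sampleIndex w)
  have h3 := h2.indepFun_finset (Finset.range j) {j} (by simp) fun l => measurable_pi_apply _
  exact h3.comp measurable_id
    (measurable_pi_apply (⟨j, Finset.mem_singleton_self j⟩ : ({j} : Finset ℕ)))

theorem measurable_smul_add_smul {d : ℕ} {β : Type*} {mβ : MeasurableSpace β}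
    {u v : β → EuclideanSpace ℝ (Fin d)} (hu : Measurable u) (hv : Measurable v) (b c : ℝ) :
    Measurable fun ω => b • u ω + c • v ω :=
  (hu.const_smul b).add (hv.const_smul c)

theorem measurable_sub_smul_normalize {d : ℕ} {β : Type*} {mβ : MeasurableSpace β}
    {u v : β → EuclideanSpace ℝ (Fin d)} (hu : Measurable u) (hv : Measurable v) (c : ℝ) :
    Measurable fun ω => u ω - c • (‖v ω‖⁻¹ • v ω) :=
  hu.sub ((hv.norm.inv.smul hv).const_smul c)

/-- The branches are decided by `control`, which is deterministic, so the case splits happen outside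
the sample space. -/
theorem measurable_run {d : ℕ} {G : EuclideanSpace ℝ (Fin d) → Ξ → EuclideanSpace ℝ (Fin d)}
    (hG : Measurable (Function.uncurry G)) (a : Params) (x₀ : EuclideanSpace ℝ (Fin d)) (j : ℕ) :
    (∀ m, Measurable[history Ξ w j] fun z : Fin n × ℕ → Ξ =>
        (run a G x₀ w (fun i m => z (i, m)) j).x m) ∧
      (Measurable[history Ξ w j] fun z : Fin n × ℕ → Ξ =>
        (run a G x₀ w (fun i m => z (i, m)) j).v) ∧
      ∀ i, Measurable[history Ξ w j] fun z : Fin n × ℕ → Ξ =>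
        (run a G x₀ w (fun i m => z (i, m)) j).point i := by
  induction j with
  | zero => simp [run, State.init]
  | succ j ih =>
    have hle := history_mono (Ξ := Ξ) w (Nat.le_succ j)
    obtain ⟨hx, hv, hp⟩ := ih
    replace hx := fun m => (hx m).mono hle le_rfl
    replace hv := hv.mono hle le_rfl
    replace hp := fun i => (hp i).mono hle le_rfl
    have hk : ∀ z : Fin n × ℕ → Ξ, (run a G x₀ w (fun i m => z (i, m)) j).k = (control a w j).1 :=
      fun z => (run_control a G x₀ w _ j).1
    have hst : ∀ z : Fin n × ℕ → Ξ, (run a G x₀ w (fun i m => z (i, m)) j).stamp =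
        (control a w j).2 := fun z => (run_control a G x₀ w _ j).2
    have hg : Measurable[history Ξ w (j + 1)] fun z : Fin n × ℕ → Ξ =>
        G ((run a G x₀ w (fun i m => z (i, m)) j).point (w j)) (z (w j, received w j (w j))) :=
      hG.comp ((hp (w j)).prodMk (measurable_sample w (Nat.lt_succ_self j)))
    have hv' : Measurable[history Ξ w (j + 1)] fun z : Fin n × ℕ → Ξ =>
        momentumWeight a.β (control a w j).1 • (run a G x₀ w (fun i m => z (i, m)) j).v +
        (1 - a.β) •
        G ((run a G x₀ w (fun i m => z (i, m)) j).point (w j)) (z (w j, received w j (w j))) :=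
      measurable_smul_add_smul hv hg _ _
    have hx' := measurable_sub_smul_normalize (hx (control a w j).1) hv' a.η
    by_cases h1 : (control a w j).1 < a.K
    · by_cases h2 : (control a w j).1 - (control a w j).2 (w j) < a.R
      · simp only [run, State.receive, hk, hst, if_pos h1, if_pos h2, State.serve, State.update]
        refine ⟨fun m => ?_, hv', fun i => ?_⟩
        · by_cases hm : m = (control a w j).1 + 1
          · subst hm
            simpa only [Function.update_self] using hx'
          · simpa only [Function.update_of_ne hm] using hx m
        · by_cases hi : i = w j
          · subst hi
            simpa only [Function.update_self] using hx'
          · simpa only [Function.update_of_ne hi] using hp i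
      · simp only [run, State.receive, hk, hst, if_pos h1, if_neg h2, State.serve]
        refine ⟨hx, hv, fun i => ?_⟩
        by_cases hi : i = w j
        · subst hi
          simpa only [Function.update_self] using hx _
        · simpa only [Function.update_of_ne hi] using hp i
    · simp only [run, State.receive, hk, if_neg h1]
      exact ⟨hx, hv, hp⟩

end History

/-! ### The parameters -/

section Parameters

theorem alpha_pos {p σ ε : ℝ} (hσ : 0 ≤ σ) (hε : 0 < ε) : 0 < alpha p σ ε := by
  rw [alpha]
  split_ifs with h
  · exact one_pos
  · have : 0 < σ := lt_of_le_of_ne hσ (Ne.symm h)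
    positivity

theorem alpha_le_one (p σ ε : ℝ) : alpha p σ ε ≤ 1 := by
  rw [alpha]
  split_ifs
  · exact le_rfl
  · exact min_le_left _ _

/-- The constant in `alpha` is chosen for this: `(3 · 2^((p+1)/p))^p = 2 · 6^p`. -/
theorem two_mul_rpow_mul_alpha_rpow_le {p σ ε : ℝ} (hp : 1 < p) (hσ : 0 ≤ σ) (hε : 0 < ε) :
    2 * σ ^ p * alpha p σ ε ^ (p - 1) ≤ (ε / 6) ^ p := by
  have hp0 : 0 < p := by linarith
  have hp1 : 0 < p - 1 := by linarith
  rcases eq_or_lt_of_le hσ with h | h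
  · rw [← h, Real.zero_rpow hp0.ne']
    simp only [mul_zero, zero_mul]
    positivity
  · set X := ε / (3 * 2 ^ ((p + 1) / p) * σ) with hX
    have hX0 : 0 < X := by positivity
    have h1 : alpha p σ ε ^ (p - 1) ≤ X ^ p := by
      have h2 : alpha p σ ε ≤ X ^ (p / (p - 1)) := by
        rw [alpha, if_neg h.ne']
        exact min_le_right _ _
      refine (Real.rpow_le_rpow (alpha_pos hσ hε).le h2 hp1.le).trans_eq ?_
      rw [← Real.rpow_mul hX0.le]
      congr 1
      field_simp
    refine (mul_le_mul_of_nonneg_left h1 (by positivity)).trans_eq ?_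
    have h3 : ((2 : ℝ) ^ ((p + 1) / p)) ^ p = 2 * 2 ^ p := by
      rw [← Real.rpow_mul zero_le_two, div_mul_cancel₀ _ hp0.ne', Real.rpow_add_one two_ne_zero,
        mul_comm]
    have h6 : (6 : ℝ) ^ p = 3 ^ p * 2 ^ p := by
      rw [← Real.mul_rpow (by norm_num) (by norm_num)]
      norm_num
    rw [hX, Real.div_rpow hε.le (by positivity), Real.mul_rpow (by positivity) h.le,
      Real.mul_rpow (by positivity) (by positivity), h3, Real.div_rpow hε.le (by positivity), h6]
    have : σ ^ p ≠ 0 := (Real.rpow_pos_of_pos h p).ne'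
    field_simp

theorem threshold_pos {p σ ε : ℝ} (hσ : 0 ≤ σ) (hε : 0 < ε) : 0 < threshold p σ ε :=
  Nat.ceil_pos.2 (one_div_pos.2 (alpha_pos hσ hε))

theorem params_K_le {L Δ p σ ε : ℝ} (hL : 0 < L) (hΔ : 0 < Δ) (hσ : 0 ≤ σ) (hε : 0 < ε) :
    (params L Δ p σ ε).K ≤ numBlocks L Δ ε * threshold p σ ε := by
  have hα := alpha_pos (p := p) hσ hε
  refine Nat.ceil_le.2 ?_
  have h1 : 74 * L * Δ / ε ^ 2 ≤ numBlocks L Δ ε := Nat.le_ceil _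
  have h2 : 1 / alpha p σ ε ≤ threshold p σ ε := Nat.le_ceil _
  push_cast
  refine le_trans ?_ (mul_le_mul h1 h2 (by positivity) (by positivity))
  rw [div_mul_div_comm, mul_one, mul_comm (alpha p σ ε)]
  gcongr
  norm_num

theorem numBlocks_le : ∃ C : ℝ, 0 < C ∧ ∀ L Δ ε : ℝ, 0 < L → 0 < Δ → 0 < ε →
    ε ≤ √(2 * L * Δ) → (numBlocks L Δ ε : ℝ) ≤ C * (L * Δ / ε ^ 2) := by
  -- The ceiling costs at most `1 ≤ 2LΔ/ε²`, hence `76 = 74 + 2`.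
  refine ⟨76, by norm_num, fun L Δ ε hL hΔ hε h => ?_⟩
  have h1 : ε ^ 2 ≤ 2 * L * Δ := (Real.le_sqrt hε.le (by positivity)).1 h
  have h2 : 1 ≤ 2 * (L * Δ / ε ^ 2) := by
    rw [← mul_div_assoc, le_div_iff₀ (by positivity)]
    linarith
  have h3 : (numBlocks L Δ ε : ℝ) ≤ 74 * L * Δ / ε ^ 2 + 1 := (Nat.ceil_lt_add_one (by positivity)).le
  have h4 : 74 * L * Δ / ε ^ 2 = 74 * (L * Δ / ε ^ 2) := by ring
  linarith

theorem threshold_isTheta (p : ℝ) (hp : 1 < p) : ∃ c C : ℝ, 0 < c ∧ 0 < C ∧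
    ∀ σ ε : ℝ, 0 < σ → 0 < ε →
      c * (⌈σ / ε⌉₊ : ℝ) ^ (p / (p - 1)) ≤ (threshold p σ ε : ℝ) ∧
      (threshold p σ ε : ℝ) ≤ C * (⌈σ / ε⌉₊ : ℝ) ^ (p / (p - 1)) := by
  set q := p / (p - 1) with hq
  have hq0 : 0 < q := div_pos (by linarith) (by linarith)
  set c₀ : ℝ := 3 * 2 ^ ((p + 1) / p) with hc₀
  have hc₀3 : 3 ≤ c₀ := by
    have : (1 : ℝ) ≤ 2 ^ ((p + 1) / p) :=
      Real.one_le_rpow (by norm_num) (div_nonneg (by linarith) (by linarith))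
    linarith
  have hcq : 0 < c₀ ^ q := Real.rpow_pos_of_pos (by linarith) _
  -- Here `1/α = max 1 ((c₀ r)^q)` with `r = σ/ε`. For `r > 1`, `⌈r⌉ ≤ r + 1 ≤ c₀ r` gives the lower
  -- constant; above, the maximum and the ceiling cost at most `2 ≤ 2⌈r⌉^q`.
  refine ⟨1, 2 + c₀ ^ q, one_pos, by positivity, fun σ ε hσ hε => ?_⟩
  set r := σ / ε with hr
  have hr0 : 0 < r := div_pos hσ hε
  have hinv : 1 / alpha p σ ε = max 1 ((c₀ * r) ^ q) := by
    rw [alpha, if_neg hσ.ne', ← hc₀, ← hq]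
    have h1 : ε / (c₀ * σ) = (c₀ * r)⁻¹ := by
      rw [hr]
      field_simp
    have hpos : 0 < (c₀ * r) ^ q := Real.rpow_pos_of_pos (by positivity) _
    rw [h1, Real.inv_rpow (by positivity)]
    rcases le_total 1 ((c₀ * r) ^ q) with h | h
    · rw [max_eq_right h, min_eq_right (inv_le_one_of_one_le₀ h), one_div, inv_inv]
    · rw [max_eq_left h, min_eq_left ((one_le_inv₀ hpos).2 h), div_one]
  have hlow : max 1 ((c₀ * r) ^ q) ≤ threshold p σ ε := hinv ▸ Nat.le_ceil _
  have hup : (threshold p σ ε : ℝ) ≤ max 1 ((c₀ * r) ^ q) + 1 := by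
    rw [← hinv]
    exact (Nat.ceil_lt_add_one (one_div_pos.2 (alpha_pos hσ.le hε)).le).le
  have hceil : r ≤ ⌈r⌉₊ := Nat.le_ceil r
  have hceil1 : (1 : ℝ) ≤ ⌈r⌉₊ := by exact_mod_cast Nat.ceil_pos.2 hr0
  constructor
  · rw [one_mul]
    refine le_trans ?_ hlow
    rcases le_or_gt r 1 with h | h
    · have : (⌈r⌉₊ : ℝ) = 1 := by
        refine le_antisymm ?_ hceil1
        exact_mod_cast Nat.ceil_le.2 (by exact_mod_cast h)
      rw [this, Real.one_rpow]
      exact le_max_left _ _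
    · refine le_trans (Real.rpow_le_rpow (by positivity) ?_ hq0.le) (le_max_right _ _)
      have := (Nat.ceil_lt_add_one hr0.le).le
      nlinarith
  · have h1 : (1 : ℝ) ≤ (⌈r⌉₊ : ℝ) ^ q := Real.one_le_rpow hceil1 hq0.le
    have h2 : (c₀ * r) ^ q ≤ c₀ ^ q * (⌈r⌉₊ : ℝ) ^ q := by
      rw [Real.mul_rpow (by linarith) hr0.le]
      exact mul_le_mul_of_nonneg_left (Real.rpow_le_rpow hr0.le hceil hq0.le) hcq.le
    have h3 : max 1 ((c₀ * r) ^ q) ≤ 1 + (c₀ * r) ^ q :=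
      max_le (by linarith [Real.rpow_nonneg (mul_nonneg (by linarith : 0 ≤ c₀) hr0.le) q])
        (by linarith)
    linarith

end Parameters

/-! ### Convergence -/

section Convergence

theorem sum_range_cast_eq (K : ℕ) : ∑ k ∈ Finset.range K, (k : ℝ) = K * (K - 1) / 2 := by
  induction K with
  | zero => simp
  | succ K ih =>
    rw [Finset.sum_range_succ, ih]
    push_cast
    ring

variable {d : ℕ} {f : EuclideanSpace ℝ (Fin d) → ℝ} {L p σ ε : ℝ} {x₀ : EuclideanSpace ℝ (Fin d)}

theorem IsSmoothObjective.iInf_le (hf : IsSmoothObjective f L) (x : EuclideanSpace ℝ (Fin d)) :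
    ⨅ x, f x ≤ f x := ciInf_le hf.bddBelow x

/-- If `ε` is large, then the iterates cannot leave the region where the gradient is small. -/
theorem IsTrajectory.sum_norm_gradient_le_of_large (hf : IsSmoothObjective f L) (hσ : 0 ≤ σ)
    (hε : 0 < ε) (hΔ : 0 < gap f x₀) (hlarge : 9 * (L * gap f x₀) ≤ 2 * ε ^ 2)
    {x v y g : ℕ → EuclideanSpace ℝ (Fin d)}
    (h : IsTrajectory (params L (gap f x₀) p σ ε) x₀ x v y g) :
    ∑ k ∈ Finset.range (params L (gap f x₀) p σ ε).K, ‖gradient f (x k)‖ ≤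
      (params L (gap f x₀) p σ ε).K * ε := by
  set a := params L (gap f x₀) p σ ε with ha
  set Δ := gap f x₀ with hΔdef
  set α := alpha p σ ε with hα
  have hα0 : 0 < α := alpha_pos hσ hε
  have hL := hf.pos
  have hη : a.η = α * ε / (24 * L) := rfl
  have hη0 : 0 < a.η := by rw [hη]; positivity
  have hg0 : ‖gradient f x₀‖ ≤ 2 / 3 * ε := by
    have h1 := norm_gradient_sq_le hL hf.differentiable hf.lipschitz hf.iInf_le x₀
    have h2 : f x₀ - ⨅ x, f x = Δ := rfl
    rw [h2] at h1
    refine (le_abs_self _).trans (abs_le_of_sq_le_sq ?_ (by positivity))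
    nlinarith
  have hK : (a.K : ℝ) - 1 ≤ 72 * L * Δ / (α * ε ^ 2) := by
    have := (Nat.ceil_lt_add_one (show 0 ≤ 72 * L * Δ / (α * ε ^ 2) by positivity)).le
    have hKdef : a.K = ⌈72 * L * Δ / (α * ε ^ 2)⌉₊ := rfl
    rw [hKdef]
    linarith
  -- The mean of the index over `0, …, K-1` is `(K-1)/2`. The drift thus averages to at most
  -- `3LΔ/(2ε) ≤ ε/3`, beside `2ε/3` for the initial gradient.
  have hdrift : L * a.η * ((a.K - 1) / 2) ≤ ε / 3 := by
    have h1 : L * a.η * ((a.K - 1) / 2) ≤ L * a.η * ((72 * L * Δ / (α * ε ^ 2)) / 2) :=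
      mul_le_mul_of_nonneg_left (by linarith) (by positivity)
    have h2 : L * a.η * ((72 * L * Δ / (α * ε ^ 2)) / 2) = 3 * (L * Δ) / (2 * ε) := by
      rw [hη]
      field_simp
      ring
    refine h1.trans ?_
    rw [h2, div_le_iff₀ (by positivity)]
    nlinarith
  have hsum := Finset.sum_le_sum fun k hk =>
    h.norm_gradient_le hη0.le hL.le hf.lipschitz (Finset.mem_range.1 hk).le
  rw [Finset.sum_add_distrib, Finset.sum_const, Finset.card_range, nsmul_eq_mul, ← Finset.mul_sum,
    ← Finset.mul_sum, sum_range_cast_eq] at hsum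
  refine hsum.trans ?_
  have h3 : (a.K : ℝ) * ‖gradient f x₀‖ + L * (a.η * (a.K * (a.K - 1) / 2)) =
      a.K * (‖gradient f x₀‖ + L * a.η * ((a.K - 1) / 2)) := by ring
  rw [h3]
  exact mul_le_mul_of_nonneg_left (by linarith) a.K.cast_nonneg

variable {n : ℕ} {Ξ : Type*} {G : EuclideanSpace ℝ (Fin d) → Ξ → EuclideanSpace ℝ (Fin d)}
  {w : ℕ → Fin n} {J : ℕ}

/-- A bound independent of the samples, so every gradient norm below is integrable. -/
theorem norm_gradient_run_le (hf : IsSmoothObjective f L) {a : Params} (hη : 0 ≤ a.η)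
    (hJ : (control a w J).1 = a.K) {k : ℕ} (hk : k < a.K) (ξ : Fin n → ℕ → Ξ) :
    ‖gradient f ((run a G x₀ w ξ J).x k)‖ ≤ ‖gradient f x₀‖ + L * (a.η * a.K) := by
  obtain ⟨idx, h0, h1, h2⟩ := exists_updateIndex hJ
  refine ((isTrajectory_run a G x₀ w ξ h0 h1 h2).norm_gradient_le hη hf.pos.le hf.lipschitz
    hk.le).trans ?_
  have : (k : ℝ) ≤ a.K := by exact_mod_cast hk.le
  have := mul_le_mul_of_nonneg_left (mul_le_mul_of_nonneg_left this hη) hf.pos.le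
  linarith

variable [MeasurableSpace Ξ] {D : Measure Ξ}

theorem measurable_norm_gradient_run (hf : IsSmoothObjective f L) (hG : IsBCMOracle D f G p σ)
    (a : Params) (k : ℕ) : Measurable fun z : Fin n × ℕ → Ξ =>
      ‖gradient f ((run a G x₀ w (fun i m => z (i, m)) J).x k)‖ :=
  (hf.continuous_gradient.measurable.comp
    (((measurable_run w hG.measurable a x₀ J).1 k).mono (history_le w J) le_rfl)).norm

variable [IsProbabilityMeasure D]

theorem integrable_norm_gradient_run (hf : IsSmoothObjective f L) (hG : IsBCMOracle D f G p σ)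
    {a : Params} (hη : 0 ≤ a.η) (hJ : (control a w J).1 = a.K) {k : ℕ} (hk : k < a.K) :
    Integrable (fun z : Fin n × ℕ → Ξ =>
      ‖gradient f ((run a G x₀ w (fun i m => z (i, m)) J).x k)‖)
      (Measure.infinitePi fun _ : Fin n × ℕ => D) :=
  Integrable.of_bound (measurable_norm_gradient_run hf hG a k).aestronglyMeasurable
    (‖gradient f x₀‖ + L * (a.η * a.K)) (Filter.Eventually.of_forall fun z => by
      rw [norm_norm]
      exact norm_gradient_run_le hf hη hJ hk _)

theorem sum_integral_norm_gradient_le (hf : IsSmoothObjective f L) (hG : IsBCMOracle D f G p σ)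
    (hp1 : 1 < p) (hp2 : p ≤ 2) (hσ : 0 ≤ σ) (hε : 0 < ε) (hΔ : 0 < gap f x₀)
    (hJ : (control (params L (gap f x₀) p σ ε) w J).1 = (params L (gap f x₀) p σ ε).K) :
    ∑ k ∈ Finset.range (params L (gap f x₀) p σ ε).K, ∫ z : Fin n × ℕ → Ξ, ‖gradient f
      ((run (params L (gap f x₀) p σ ε) G x₀ w (fun i m => z (i, m)) J).x k)‖
        ∂(Measure.infinitePi fun _ : Fin n × ℕ => D) ≤
      (params L (gap f x₀) p σ ε).K * ε := by
  set a := params L (gap f x₀) p σ ε with ha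
  set Δ := gap f x₀ with hΔdef
  set α := alpha p σ ε with hα
  set Q := Measure.infinitePi fun _ : Fin n × ℕ => D with hQ
  have hα0 : 0 < α := alpha_pos hσ hε
  have hα1 : α ≤ 1 := alpha_le_one p σ ε
  have hL := hf.pos
  have hη : a.η = α * ε / (24 * L) := rfl
  have hβ : a.β = 1 - α := rfl
  have hη0 : 0 < a.η := by rw [hη]; positivity
  have hβ0 : 0 ≤ a.β := by rw [hβ]; linarith
  have hβ1 : a.β < 1 := by rw [hβ]; linarith
  have hβα : 1 - a.β = α := by rw [hβ]; ring
  have hint : ∀ k ∈ Finset.range a.K, Integrable (fun z : Fin n × ℕ → Ξ =>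
      ‖gradient f ((run a G x₀ w (fun i m => z (i, m)) J).x k)‖) Q := fun k hk =>
    integrable_norm_gradient_run hf hG hη0.le hJ (Finset.mem_range.1 hk)
  obtain ⟨idx, h0, h1, h2⟩ := exists_updateIndex hJ
  have htraj := fun z : Fin n × ℕ → Ξ =>
    isTrajectory_run a G x₀ w (fun i m => z (i, m)) h0 h1 h2
  rw [← integral_finsetSum _ hint]
  -- The threshold is where `72LΔ/ε²`, a lower bound for `Kα`, equals `16`.
  rcases le_or_gt (9 * (L * Δ)) (2 * ε ^ 2) with hlarge | hsmall
  · refine (integral_mono (integrable_finsetSum _ hint) (integrable_const (a.K * ε))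
      fun z => (htraj z).sum_norm_gradient_le_of_large hf hσ hε hΔ hlarge).trans ?_
    simp
  have hKα : 72 * L * Δ / (α * ε ^ 2) ≤ a.K := Nat.le_ceil _
  have hK16 : 16 ≤ a.K * α := by
    have h3 := mul_le_mul_of_nonneg_right hKα hα0.le
    refine le_trans ?_ h3
    have : 72 * L * Δ / (α * ε ^ 2) * α = 72 * (L * Δ) / ε ^ 2 := by field_simp
    rw [this, le_div_iff₀ (by positivity)]
    linarith
  set N : ℕ → (Fin n × ℕ → Ξ) → EuclideanSpace ℝ (Fin d) := fun k z => momentum a.β (fun l =>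
    G ((run a G x₀ w (fun i m => z (i, m)) (idx l)).point (w (idx l)))
      (z (w (idx l), received w (idx l) (w (idx l)))) -
    gradient f ((run a G x₀ w (fun i m => z (i, m)) (idx l)).point (w (idx l)))) k with hN
  have hidx : ∀ k < a.K, idx k + 1 ≤ idx (k + 1) := by
    intro k hk
    by_contra! hlt
    have : (control a w (idx (k + 1))).1 ≤ (control a w (idx k)).1 := control_mono a w (by omega)
    rw [h1 k hk.le, h1 _ hk] at this
    omega
  have hNint : ∀ k < a.K, Integrable (fun z => ‖N (k + 1) z‖) Q ∧
      ∫ z, ‖N (k + 1) z‖ ∂Q ≤ ε / 6 * √(totalWeight a.β (k + 1)) := by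
    intro k hk
    have hW0 : 0 < totalWeight a.β (k + 1) :=
      lt_of_lt_of_le (by linarith) (le_totalWeight_succ hβ0 hβ1.le k)
    have hW1 := totalWeight_le_one hβ0 hβ1.le (k + 1)
    obtain ⟨m1, m2, m3⟩ := integral_norm_momentum_noise_rpow_le (Q := Q) (K := a.K) hf hG hp1 hp2
      hβ0 hβ1 (ℱ := fun k => history Ξ w (idx k))
      (ζ := fun k z => z (w (idx k), received w (idx k) (w (idx k))))
      (y := fun k z => (run a G x₀ w (fun i m => z (i, m)) (idx k)).point (w (idx k)))
      (fun k => history_le w _) (fun k hk => history_mono w (Nat.le_of_succ_le (hidx k hk)))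
      (fun k _ => indep_history w D (idx k)) (fun k hk => measurable_sample w (hidx k hk))
      (fun k _ => Measure.infinitePi_map_eval (fun _ : Fin n × ℕ => D) _)
      (fun k _ => (measurable_run w hG.measurable a x₀ (idx k)).2.2 _) (k := k + 1) hk
    refine integral_le_of_integral_rpow_le hp1.le (by positivity) (fun z => norm_nonneg _) m2
      ((m1.mono (history_le w _) le_rfl).norm.aestronglyMeasurable) (m3.trans ?_)
    rw [hβα, Real.mul_rpow (by positivity) (by positivity)]
    refine mul_le_mul (two_mul_rpow_mul_alpha_rpow_le hp1 hσ hε) ?_ hW0.le (by positivity)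
    -- Since `W ≤ 1` and `p/2 ≤ 1`, `W ≤ W^(p/2) = (√W)^p`.
    rw [Real.sqrt_eq_rpow, ← Real.rpow_mul hW0.le]
    have := Real.rpow_le_rpow_of_exponent_ge hW0 hW1 (by linarith : 1 / 2 * p ≤ 1)
    rwa [Real.rpow_one] at this
  set B := L * a.η * (a.β / (1 - a.β) + (a.R - 1)) with hB
  have hpath := fun z => (htraj z).sum_norm_gradient_le hη0 hL.le hf.differentiable hf.lipschitz
    hβ0 hβ1 hf.iInf_le
  have hint₁ : ∀ k ∈ Finset.range a.K, Integrable (fun z =>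
      ‖N (k + 1) z‖ / totalWeight a.β (k + 1) + B) Q := fun k hk =>
    ((hNint k (Finset.mem_range.1 hk)).1.div_const _).add (integrable_const _)
  have hint₂ : Integrable (fun z => 2 * ∑ k ∈ Finset.range a.K,
      (‖N (k + 1) z‖ / totalWeight a.β (k + 1) + B)) Q :=
    (integrable_finsetSum _ hint₁).const_mul 2
  refine (integral_mono (integrable_finsetSum _ hint) ((integrable_const _).add hint₂)
    hpath).trans ?_
  have hIadd := integral_add (μ := Q)
    (integrable_const ((f x₀ - ⨅ x, f x) / a.η + a.K * (L * a.η / 2))) hint₂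
  refine hIadd.trans_le ?_
  rw [integral_const, probReal_univ, one_smul, integral_const_mul, integral_finsetSum _ hint₁]
  have hterm : ∀ k ∈ Finset.range a.K, ∫ z, (‖N (k + 1) z‖ / totalWeight a.β (k + 1) + B) ∂Q ≤
      ε / 6 * (1 / √(totalWeight a.β (k + 1))) + B := by
    intro k hk
    obtain ⟨i1, i2⟩ := hNint k (Finset.mem_range.1 hk)
    have hW0 : 0 < totalWeight a.β (k + 1) :=
      lt_of_lt_of_le (by linarith) (le_totalWeight_succ hβ0 hβ1.le k)
    rw [integral_add (i1.div_const _) (integrable_const _), integral_div, integral_const,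
      probReal_univ, one_smul]
    refine add_le_add ((div_le_div_of_nonneg_right i2 hW0.le).trans_eq ?_) le_rfl
    rw [mul_div_assoc, Real.sqrt_div_self']
  have hsum := Finset.sum_le_sum hterm
  rw [Finset.sum_add_distrib, ← Finset.mul_sum, Finset.sum_const, Finset.card_range,
    nsmul_eq_mul] at hsum
  have hweights := mul_le_mul_of_nonneg_left (sum_inv_sqrt_totalWeight_le_mul hα0 hα1 hK16)
    (by positivity : 0 ≤ ε / 6)
  rw [← hβ] at hweights
  have hBle : B ≤ ε * (2 - α) / 24 := by
    have hR : (a.R : ℝ) - 1 ≤ 1 / α := by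
      have := (Nat.ceil_lt_add_one (one_div_pos.2 hα0).le).le
      have hRdef : a.R = ⌈1 / α⌉₊ := rfl
      rw [hRdef]
      linarith
    have h3 : B ≤ L * a.η * (a.β / (1 - a.β) + 1 / α) :=
      mul_le_mul_of_nonneg_left (by linarith) (by positivity)
    refine h3.trans_eq ?_
    rw [hβα, hβ, hη]
    field_simp
    ring
  have hfirst : (f x₀ - ⨅ x, f x) / a.η ≤ a.K * ε / 3 := by
    have h3 : (f x₀ - ⨅ x, f x) / a.η = 72 * L * Δ / (α * ε ^ 2) * ε / 3 := by
      have : f x₀ - ⨅ x, f x = Δ := rfl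
      rw [this, hη]
      field_simp
      ring
    rw [h3]
    gcongr
  have hsecond : L * a.η / 2 = α * ε / 48 := by
    rw [hη]
    field_simp
    ring
  have hK0 : (0 : ℝ) ≤ a.K := a.K.cast_nonneg
  have hB' := mul_le_mul_of_nonneg_left hBle hK0
  have hαK : 0 ≤ a.K * (α * ε) := by positivity
  rw [hsecond]
  -- Per iteration: `ε/3` from the initial gap, `2 · (ε/6) · (3/2) = ε/2` from noise, `ε/6 - αε/12`
  -- from drift and `αε/48` from curvature, at most `ε` in total.
  linarith

theorem integral_uniformOn_Iio {K : ℕ} (φ : ℕ → ℝ) :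
    ∫ k, φ k ∂(uniformOn (Set.Iio K)) = (K : ℝ)⁻¹ * ∑ k ∈ Finset.range K, φ k := by
  have hset : Set.Iio K = (Finset.range K : Set ℕ) := by
    ext k
    simp
  have hint : IntegrableOn φ (Finset.range K : Set ℕ) Measure.count := by
    have : IsFiniteMeasure (Measure.count.restrict (Finset.range K : Set ℕ)) :=
      ⟨by simp [← hset, Set.finite_Iio]⟩
    have h := IntegrableOn.finset (μ := Measure.count.restrict (Finset.range K : Set ℕ)) (f := φ)
      (s := Finset.range K)
    rwa [IntegrableOn, Measure.restrict_restrict (Finset.measurableSet _), Set.inter_self] at h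
  rw [uniformOn, ProbabilityTheory.cond, integral_smul_measure, hset, setIntegral_finset _ hint,
    Measure.count_apply_finset]
  simp

variable {Ω : Type*} [MeasurableSpace Ω] {P : Measure Ω} [IsProbabilityMeasure P]
  {ξ : Fin n → ℕ → Ω → Ξ} {U : Ω → ℕ}

/-- The output index and the samples have a product joint law, so the expectation is the average
over `k < K` of the expected gradient norms. -/
theorem integral_norm_gradient_output_le (hf : IsSmoothObjective f L)
    (hG : IsBCMOracle D f G p σ) (hp1 : 1 < p) (hp2 : p ≤ 2) (hσ : 0 ≤ σ) (hε : 0 < ε)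
    (hΔ : 0 < gap f x₀) (hξ : ∀ i m, HasLaw (ξ i m) D P)
    (hindep : iIndepFun (fun q : Fin n × ℕ => ξ q.1 q.2) P)
    (hU : HasLaw U (uniformOn (Set.Iio (params L (gap f x₀) p σ ε).K)) P)
    (hUξ : IndepFun U (fun ω (q : Fin n × ℕ) => ξ q.1 q.2 ω) P)
    (hJ : (control (params L (gap f x₀) p σ ε) w J).1 = (params L (gap f x₀) p σ ε).K) :
    Integrable (fun ω => ‖gradient f
        ((run (params L (gap f x₀) p σ ε) G x₀ w (fun i m => ξ i m ω) J).x (U ω))‖) P ∧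
      ∫ ω, ‖gradient f
        ((run (params L (gap f x₀) p σ ε) G x₀ w (fun i m => ξ i m ω) J).x (U ω))‖ ∂P ≤ ε := by
  set a := params L (gap f x₀) p σ ε with ha
  have hα0 : 0 < alpha p σ ε := alpha_pos hσ hε
  have hL := hf.pos
  have hη : a.η = alpha p σ ε * ε / (24 * L) := rfl
  have hη0 : 0 < a.η := by rw [hη]; positivity
  have hK0 : 0 < a.K := Nat.ceil_pos.2 (by positivity)
  have hX : HasLaw (fun ω (q : Fin n × ℕ) => ξ q.1 q.2 ω)
      (Measure.infinitePi fun _ : Fin n × ℕ => D) P :=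
    hindep.hasLaw_infinitePi (fun q => hξ q.1 q.2)
      (aemeasurable_pi_lambda _ fun q => (hξ q.1 q.2).aemeasurable)
  have hpair : AEMeasurable (fun ω => (U ω, fun q : Fin n × ℕ => ξ q.1 q.2 ω)) P :=
    hU.aemeasurable.prodMk hX.aemeasurable
  have : IsProbabilityMeasure (uniformOn (Set.Iio a.K)) :=
    isProbabilityMeasure_uniformOn (Set.finite_Iio _) ⟨0, hK0⟩
  have hlaw : P.map (fun ω => (U ω, fun q : Fin n × ℕ => ξ q.1 q.2 ω)) =
      (uniformOn (Set.Iio a.K)).prod (Measure.infinitePi fun _ : Fin n × ℕ => D) := by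
    rw [(indepFun_iff_map_prod_eq_prod_map_map hU.aemeasurable hX.aemeasurable).1 hUξ, hU.map_eq,
      hX.map_eq]
  set h : ℕ × (Fin n × ℕ → Ξ) → ℝ := fun q =>
    ‖gradient f ((run a G x₀ w (fun i m => q.2 (i, m)) J).x q.1)‖ with hh
  have hmeas : Measurable h :=
    measurable_from_prod_countable_right fun k => measurable_norm_gradient_run hf hG a k
  -- The law of `U` confines it below `K` only almost surely, and the uniform gradient bound covers
  -- only such indices.
  have hUlt : ∀ᵐ ω ∂P, U ω < a.K := by
    have h1 : ∀ᵐ k ∂(uniformOn (Set.Iio a.K)), k ∈ Set.Iio a.K := by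
      rw [uniformOn]
      exact ae_cond_mem measurableSet_Iio
    rw [← hU.map_eq] at h1
    exact ae_of_ae_map hU.aemeasurable h1
  have hint : Integrable (fun ω => h (U ω, fun q : Fin n × ℕ => ξ q.1 q.2 ω)) P := by
    refine Integrable.of_bound (hmeas.comp_aemeasurable hpair).aestronglyMeasurable
      (‖gradient f x₀‖ + L * (a.η * a.K)) ?_
    filter_upwards [hUlt] with ω hω
    rw [hh, norm_norm]
    exact norm_gradient_run_le hf hη0.le hJ hω _
  refine ⟨hint, ?_⟩
  have hint' := (integrable_map_measure hmeas.aestronglyMeasurable hpair).2 hint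
  have h1 : ∫ ω, h (U ω, fun q : Fin n × ℕ => ξ q.1 q.2 ω) ∂P ≤ ε := by
    rw [← integral_map hpair hmeas.aestronglyMeasurable]
    rw [hlaw] at hint' ⊢
    rw [integral_prod _ hint', integral_uniformOn_Iio, inv_mul_le_iff₀ (by exact_mod_cast hK0)]
    exact sum_integral_norm_gradient_le hf hG hp1 hp2 hσ hε hΔ hJ
  exact h1

end Convergence

end RANSGDm

theorem mainTheorem3 :
    -- the algorithm finds an `ε`-stationary point by time `T_K̄`
    (∀ (n d : ℕ) (Ξ Ω : Type*) [MeasurableSpace Ξ] [MeasurableSpace Ω]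
      (D : Measure Ξ) [IsProbabilityMeasure D] (P : Measure Ω) [IsProbabilityMeasure P]
      (f : EuclideanSpace ℝ (Fin d) → ℝ)
      (G : EuclideanSpace ℝ (Fin d) → Ξ → EuclideanSpace ℝ (Fin d))
      (x₀ : EuclideanSpace ℝ (Fin d)) (L p σ ε : ℝ)
      (υ : Fin n → ℝ → ℝ) (w : ℕ → Fin n)
      (ξ : Fin n → ℕ → Ω → Ξ) (U : Ω → ℕ),
      RANSGDm.IsSmoothObjective f L →
      1 < p → p ≤ 2 → 0 ≤ σ → 0 < ε →
      RANSGDm.IsBCMOracle D f G p σ →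
      0 < RANSGDm.gap f x₀ →
      (∀ i, RANSGDm.IsComputationPower (υ i)) →
      RANSGDm.IsSchedule υ w →
      -- the samples are i.i.d. with law `D`
      (∀ i m, HasLaw (ξ i m) D P) →
      iIndepFun (fun q : Fin n × ℕ => ξ q.1 q.2) P →
      -- the output index is uniform on `{0, …, K - 1}` and independent of the samples
      HasLaw U (uniformOn (Set.Iio (RANSGDm.params L (RANSGDm.gap f x₀) p σ ε).K)) P →
      IndepFun U (fun ω (q : Fin n × ℕ) => ξ q.1 q.2 ω) P →
      -- every finite `T_{K+1}` is an attained minimum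
      (∀ K : ℕ, RANSGDm.blockTime υ (RANSGDm.threshold p σ ε) (K + 1) ≠ ∞ →
        IsLeast {t : ℝ | 0 ≤ t ∧ RANSGDm.blockGoal υ (RANSGDm.threshold p σ ε)
            (RANSGDm.blockTime υ (RANSGDm.threshold p σ ε) K).toReal t}
          (RANSGDm.blockTime υ (RANSGDm.threshold p σ ε) (K + 1)).toReal) ∧
      -- by the time `T_K̄` the server has made its `K` updates and stopped, and the output is
      -- `ε`-stationary in expectation
      (RANSGDm.blockTime υ (RANSGDm.threshold p σ ε)
          (RANSGDm.numBlocks L (RANSGDm.gap f x₀) ε) ≠ ∞ →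
        ∃ J : ℕ,
          (∀ j < J, RANSGDm.arrivalTime υ w j ≤
            RANSGDm.blockTime υ (RANSGDm.threshold p σ ε)
              (RANSGDm.numBlocks L (RANSGDm.gap f x₀) ε)) ∧
          (∀ ω, (RANSGDm.run (RANSGDm.params L (RANSGDm.gap f x₀) p σ ε) G x₀ w
            (fun i m => ξ i m ω) J).k = (RANSGDm.params L (RANSGDm.gap f x₀) p σ ε).K) ∧
          Integrable (fun ω => ‖gradient f
            ((RANSGDm.run (RANSGDm.params L (RANSGDm.gap f x₀) p σ ε) G x₀ w
              (fun i m => ξ i m ω) J).x (U ω))‖) P ∧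
          ∫ ω, ‖gradient f
            ((RANSGDm.run (RANSGDm.params L (RANSGDm.gap f x₀) p σ ε) G x₀ w
              (fun i m => ξ i m ω) J).x (U ω))‖ ∂P ≤ ε)) ∧
    -- `K̄ = O(LΔ/ε²)`
    (∃ C : ℝ, 0 < C ∧ ∀ L Δ ε : ℝ, 0 < L → 0 < Δ → 0 < ε → ε ≤ √(2 * L * Δ) →
      (RANSGDm.numBlocks L Δ ε : ℝ) ≤ C * (L * Δ / ε ^ 2)) ∧
    -- `R = Θ(⌈σ/ε⌉^(p/(p-1)))`, with constants that depend only on `p`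
    (∀ p : ℝ, 1 < p → p ≤ 2 → ∃ c C : ℝ, 0 < c ∧ 0 < C ∧ ∀ σ ε : ℝ, 0 < σ → 0 < ε →
      c * (⌈σ / ε⌉₊ : ℝ) ^ (p / (p - 1)) ≤ (RANSGDm.threshold p σ ε : ℝ) ∧
      (RANSGDm.threshold p σ ε : ℝ) ≤ C * (⌈σ / ε⌉₊ : ℝ) ^ (p / (p - 1))) := by
  refine ⟨?_, RANSGDm.numBlocks_le, fun p hp1 _ => RANSGDm.threshold_isTheta p hp1⟩
  intro n d Ξ Ω _ _ D _ P _ f G x₀ L p σ ε υ w ξ U hf hp1 hp2 hσ hε hG hΔ hυ hw hξ hindep hU hUξ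
  refine ⟨fun K hK => RANSGDm.isLeast_blockTime hυ hK, fun hT => ?_⟩
  obtain ⟨J, harr, hJ⟩ := RANSGDm.exists_control_eq
    (a := RANSGDm.params L (RANSGDm.gap f x₀) p σ ε) hw hυ (RANSGDm.threshold_pos hσ hε)
    (RANSGDm.params_K_le hf.pos hΔ hσ hε) hT
  exact ⟨J, harr, fun ω => (RANSGDm.run_control _ G x₀ w _ J).1.trans hJ,
    RANSGDm.integral_norm_gradient_output_le hf hG hp1 hp2 hσ hε hΔ hξ hindep hU hUξ hJ⟩
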